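/- Let $K$ be a local field of characteristic $0$, i.e. a non-discrete locally compact field of characteristic $0$ (archimedean or non-archimedean), whose topology is given by an absolute value. Let $n\ge 1$ and $G=\mathrm{SL}_2(K)^n$. For $\mathbf t=(t_1,\dots,t_n)\in K^n$ put $$w(\mathbf t)=\left(\begin{pmatrix}1&t_1\\0&1\end{pmatrix},\dots,\begin{pmatrix}1&t_n\\0&1\end{pmatrix}\right)\in G,$$ and let $$U=\{w(t,\dots,t):t\in K\},\qquad U^\perp=\{w(t_1,\dots,t_{n-1},0):t_1,\dots,t_{n-1}\in K\},\qquad H=\{(g,\dots,g)\in G:g\in\mathrm{SL}_2(K)\}.$$ For $j=1,\dots,n$ let $\Gamma_j$ be a discrete subgroup of $\mathrm{SL}_2(K)$ such that $\mathrm{SL}_2(K)/\Gamma_j$ is compact, and let $\Gamma=\Gamma_1\times\dots\times\Gamma_n\subset G$. The group $G$ acts on $G/\Gamma$, with the quotient topology, by left translations. A set $X\subset G/\Gamma$ is called $U$-minimal if it is nonempty, closed and $U$-invariant, and contains no nonempty closed $U$-invariant subset other than itself. A nontrivial one-parameter subgroup of $U^\perp$ is a subgroup of the form $\{w(s\mathbf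 v):s\in K\}$, where $\mathbf v\in K^n$ is a nonzero vector whose last coordinate is $0$. Let $X$ be a $U$-minimal subset of $G/\Gamma$. Then either $X$ is a closed orbit of $wHw^{-1}$ for some $w\in U^\perp$, or $X$ is invariant under a nontrivial one-parameter subgroup of $U^\perp$. (The "or" is inclusive.) -/

import Mathlib

namespace UnipotentFlow

/-- The group `G = SL₂(K)ⁿ`. It carries the product of the topologies of the factors. -/
abbrev G (n : ℕ) (K : Type*) [Field K] : Type _ :=
  Fin n → Matrix.SpecialLinearGroup (Fin 2) K

section Groups

variable {n : ℕ} {K : Type*} [Field K]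

/-- The upper triangular unipotent matrix `w₁(t)` with upper right entry `t`. -/
def w₁ (t : K) : Matrix.SpecialLinearGroup (Fin 2) K :=
  ⟨!![1, t; 0, 1], by simp [Matrix.det_fin_two]⟩

theorem w₁_zero : w₁ (0 : K) = 1 := by
  ext i j
  fin_cases i <;> fin_cases j <;> simp [w₁]

theorem w₁_add (s t : K) : w₁ (s + t) = w₁ s * w₁ t := by
  ext i j
  rw [Matrix.SpecialLinearGroup.coe_mul]
  fin_cases i <;> fin_cases j <;> simp [w₁, add_comm]

/-- The element `w(t) = (w₁(t₁), …, w₁(tₙ))` of `G`. -/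
def w (t : Fin n → K) : G n K := fun i => w₁ (t i)

theorem w_zero : w (0 : Fin n → K) = 1 := by
  funext i
  exact w₁_zero

theorem w_add (s t : Fin n → K) : w (s + t) = w s * w t := by
  funext i
  exact w₁_add (s i) (t i)

theorem w_neg (t : Fin n → K) : w (-t) = (w t)⁻¹ := by
  rw [eq_inv_iff_mul_eq_one, ← w_add, neg_add_cancel, w_zero]

/-- The multi-parameter subgroup `{w(t) : t ∈ E}` attached to a subspace `E` of `Kⁿ`. -/
def multiParam (E : Submodule K (Fin n → K)) : Subgroup (G n K) where
  carrier := {g | ∃ t ∈ E, g = w t}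
  one_mem' := ⟨0, E.zero_mem, w_zero.symm⟩
  mul_mem' := by
    rintro _ _ ⟨s, hs, rfl⟩ ⟨t, ht, rfl⟩
    exact ⟨s + t, E.add_mem hs ht, (w_add s t).symm⟩
  inv_mem' := by
    rintro _ ⟨t, ht, rfl⟩
    exact ⟨-t, E.neg_mem ht, (w_neg t).symm⟩

variable (n K)

/-- `U = {w(t, …, t) : t ∈ K}`. -/
def U : Subgroup (G n K) where
  carrier := {g | ∃ t : K, g = w (fun _ => t)}
  one_mem' := ⟨0, w_zero.symm⟩
  mul_mem' := by
    rintro _ _ ⟨s, rfl⟩ ⟨t, rfl⟩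
    exact ⟨s + t, (w_add _ _).symm⟩
  inv_mem' := by
    rintro _ ⟨t, rfl⟩
    exact ⟨-t, (w_neg _).symm⟩

/-- `U^⊥ = {w(t₁, …, tₙ₋₁, 0) : tⱼ ∈ K}`: the last coordinate vanishes. -/
def Uperp : Subgroup (G n K) where
  carrier := {g | ∃ t : Fin n → K, (∀ i : Fin n, (i : ℕ) + 1 = n → t i = 0) ∧ g = w t}
  one_mem' := ⟨0, fun _ _ => rfl, w_zero.symm⟩
  mul_mem' := by
    rintro _ _ ⟨s, hs, rfl⟩ ⟨t, ht, rfl⟩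
    exact ⟨s + t, fun i hi => by simp [hs i hi, ht i hi], (w_add s t).symm⟩
  inv_mem' := by
    rintro _ ⟨t, ht, rfl⟩
    exact ⟨-t, fun i hi => by simp [ht i hi], (w_neg t).symm⟩

/-- `H = {(g, …, g) : g ∈ SL₂(K)}`, the diagonal subgroup of `G`. -/
def H : Subgroup (G n K) where
  carrier := {h | ∃ g : Matrix.SpecialLinearGroup (Fin 2) K, h = fun _ => g}
  one_mem' := ⟨1, rfl⟩
  mul_mem' := by
    rintro _ _ ⟨g, rfl⟩ ⟨h, rfl⟩
    exact ⟨g * h, rfl⟩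
  inv_mem' := by
    rintro _ ⟨g, rfl⟩
    exact ⟨g⁻¹, rfl⟩

variable {n K}

/-- The conjugate `g F g⁻¹` of a subgroup `F` of `G`. -/
def conj (g : G n K) (F : Subgroup (G n K)) : Subgroup (G n K) :=
  F.map (MulAut.conj g).toMonoidHom

/-- A nontrivial one-parameter subgroup `{w(s v) : s ∈ K}`, `v ≠ 0`: the multi-parameter
subgroup of a line in `Kⁿ`. -/
def IsNontrivialOneParameter (V : Subgroup (G n K)) : Prop :=
  ∃ v : Fin n → K, v ≠ 0 ∧ V = multiParam (Submodule.span K {v})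

end Groups

section Minimal

variable {A Ω : Type*} [Group A] [MulAction A Ω]

/-- `X` is invariant under the subgroup `F`. -/
def IsInvariant (F : Subgroup A) (X : Set Ω) : Prop :=
  ∀ g ∈ F, ∀ x ∈ X, g • x ∈ X

/-- `X` is `F`-minimal: it is a nonempty closed `F`-invariant set, and it contains no nonempty
closed `F`-invariant set other than itself. -/
def IsMinimalSet [TopologicalSpace Ω] (F : Subgroup A) (X : Set Ω) : Prop :=
  X.Nonempty ∧ IsClosed X ∧ IsInvariant F X ∧
    ∀ Y : Set Ω, Y ⊆ X → Y.Nonempty → IsClosed Y → IsInvariant F Y → Y = X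

/-- `X` is a closed orbit of the subgroup `F`. -/
def IsClosedOrbit [TopologicalSpace Ω] (F : Subgroup A) (X : Set Ω) : Prop :=
  IsClosed X ∧ ∃ x : Ω, X = {y | ∃ g ∈ F, y = g • x}

end Minimal

end UnipotentFlow

/-! The proof studies the set `returns X` of those `g` for which `g • X` meets `X`; it is closed
because the quotient is compact. The elements `bor α v` form a group B normalizing U, so for `b` in
B the set `X ∩ b • X` is closed and U-invariant. By minimality, every element of B in `returns X`
stabilizes X (`IsMinimalSet.bor_mem_stabilizer`). It remains to produce such elements.

Unipotents fix no point of a compact quotient by a discrete group (`eq_zero_of_w_smul_eq`), and this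
forces returns outside B arbitrarily close to 1 (`one_mem_closure_returns_diff`). Shearing these
returns by U on both sides and passing to the limit gives a nonconstant curve in B that stabilizes X
(`exists_limit_curve`). Such a curve generates either a line of `U^⊥`, and the proof is over, or a
conjugate of the diagonal torus by some `w z` (`line_or_torus_of_curve`).

In the torus case X is replaced by its translate by `(w z)⁻¹`. If returns outside H accumulate at 1,
expanding them by the torus again gives a line (`line_of_one_mem_closure_diff`). Otherwise the
translate lies in one H-orbit, and it is all of that orbit once it is shown to be invariant under
the Weyl element (`IsMinimalSet.weyl_smul_mem`). -/

namespace UnipotentFlow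

open Filter Topology Pointwise

/-! ### Matrix identities for triangular, unipotent and Weyl elements. -/

section Algebra

variable {n : ℕ} {K : Type*} [Field K]

/-- The element of `G` whose components are upper triangular with common diagonal `(α, α⁻¹)`
and upper right entries `v`. -/
def bor (α : Kˣ) (v : Fin n → K) : G n K :=
  fun j => ⟨!![(α : K), v j; 0, (α⁻¹ : Kˣ)], by simp [Matrix.det_fin_two]⟩

/-- The lower triangular unipotent matrix with lower left entry `r`. -/
def low (r : K) : Matrix.SpecialLinearGroup (Fin 2) K :=
  ⟨!![1, 0; r, 1], by simp [Matrix.det_fin_two]⟩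

/-- The Weyl element of `SL₂`. -/
def weyl : Matrix.SpecialLinearGroup (Fin 2) K :=
  ⟨!![0, 1; -1, 0], by simp [Matrix.det_fin_two]⟩

theorem sl_ext {g h : Matrix.SpecialLinearGroup (Fin 2) K} (h₀ : g 0 0 = h 0 0)
    (h₁ : g 0 1 = h 0 1) (h₂ : g 1 0 = h 1 0) (h₃ : g 1 1 = h 1 1) : g = h := by
  ext i j
  fin_cases i <;> fin_cases j <;> assumption

theorem sl_det (g : Matrix.SpecialLinearGroup (Fin 2) K) :
    g 0 0 * g 1 1 - g 0 1 * g 1 0 = 1 := by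
  rw [← Matrix.det_fin_two, g.det_coe]

theorem sl_mul_apply (g h : Matrix.SpecialLinearGroup (Fin 2) K) (i j : Fin 2) :
    (g * h) i j = g i 0 * h 0 j + g i 1 * h 1 j := by
  rw [Matrix.SpecialLinearGroup.coe_mul, Matrix.mul_apply, Fin.sum_univ_two]

section Entries

variable (α : Kˣ) (v : Fin n → K) (j : Fin n) (t : K)

@[simp] theorem bor_00 : bor α v j 0 0 = α := rfl
@[simp] theorem bor_01 : bor α v j 0 1 = v j := rfl
@[simp] theorem bor_10 : bor α v j 1 0 = 0 := rfl
@[simp] theorem bor_11 : bor α v j 1 1 = (α : K)⁻¹ := by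
  rw [← Units.val_inv_eq_inv_val]; rfl
@[simp] theorem w₁_00 : w₁ t 0 0 = 1 := rfl
@[simp] theorem w₁_01 : w₁ t 0 1 = t := rfl
@[simp] theorem w₁_10 : w₁ t 1 0 = 0 := rfl
@[simp] theorem w₁_11 : w₁ t 1 1 = 1 := rfl
@[simp] theorem low_00 : low t 0 0 = 1 := rfl
@[simp] theorem low_01 : low t 0 1 = 0 := rfl
@[simp] theorem low_10 : low t 1 0 = t := rfl
@[simp] theorem low_11 : low t 1 1 = 1 := rfl
@[simp] theorem weyl_00 : (weyl : Matrix.SpecialLinearGroup (Fin 2) K) 0 0 = 0 := rfl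
@[simp] theorem weyl_01 : (weyl : Matrix.SpecialLinearGroup (Fin 2) K) 0 1 = 1 := rfl
@[simp] theorem weyl_10 : (weyl : Matrix.SpecialLinearGroup (Fin 2) K) 1 0 = -1 := rfl
@[simp] theorem weyl_11 : (weyl : Matrix.SpecialLinearGroup (Fin 2) K) 1 1 = 0 := rfl

end Entries

theorem w_apply (v : Fin n → K) (j : Fin n) : w v j = w₁ (v j) := rfl

theorem bor_one (v : Fin n → K) : bor 1 v = w v := by
  funext j
  apply sl_ext <;> simp [w_apply]

theorem bor_mul (α β : Kˣ) (v u : Fin n → K) :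
    bor α v * bor β u = bor (α * β) (fun j => α * u j + v j * (β : K)⁻¹) := by
  funext j
  apply sl_ext <;> simp [sl_mul_apply, mul_comm]

theorem bor_inv (α : Kˣ) (v : Fin n → K) : (bor α v)⁻¹ = bor α⁻¹ (-v) := by
  rw [inv_eq_iff_mul_eq_one, bor_mul, mul_inv_cancel, ← w_zero, bor_one]
  congr 1
  funext j
  simp
  ring

theorem bor_conj_w (α : Kˣ) (v u : Fin n → K) :
    bor α v * w u * (bor α v)⁻¹ = w (((α : K) ^ 2) • u) := by
  rw [← bor_one, bor_inv, bor_mul, bor_mul, ← bor_one]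
  congr 1
  · simp
  · funext j
    simp
    ring

/-- The commutator of two elements `bor`. -/
theorem bor_commutator (α β : Kˣ) (v u : Fin n → K) :
    bor α v * bor β u * (bor β u * bor α v)⁻¹ =
      w (fun j => (α * β : K) * ((α - (α : K)⁻¹) * u j - (β - (β : K)⁻¹) * v j)) := by
  rw [bor_mul, bor_mul, bor_inv, bor_mul, ← bor_one]
  congr 1
  · rw [mul_comm β α, mul_inv_cancel]
  · funext j
    simp
    ring

theorem w_conj_bor (α : Kˣ) (z : Fin n → K) :
    w z * bor α 0 * (w z)⁻¹ = bor α (fun j => ((α : K)⁻¹ - α) * z j) := by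
  rw [← w_neg, ← bor_one, ← bor_one, bor_mul, bor_mul]
  congr 1
  · simp
  · funext j
    simp
    ring

theorem w_injective : Function.Injective (w : (Fin n → K) → G n K) := fun u v h => by
  funext j
  have := congrArg (fun g : G n K => g j 0 1) h
  simpa [w_apply] using this

/-- The squares of a field of characteristic different from two span it additively. -/
theorem mem_of_sq_smul_mem [NeZero (2 : K)] (M : AddSubgroup (Fin n → K)) (v : Fin n → K)
    (hv : ∀ α : Kˣ, ((α : K) ^ 2) • v ∈ M) (s : K) : s • v ∈ M := by
  have h : ∀ a : K, (a ^ 2) • v ∈ M := fun a => by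
    by_cases ha : a = 0
    · simp [ha, M.zero_mem]
    · exact hv (Units.mk0 a ha)
  have h2 : (2 : K) ≠ 0 := NeZero.ne _
  have e : s • v = (((s + 1) / 2) ^ 2) • v - (((s - 1) / 2) ^ 2) • v := by
    rw [← sub_smul]
    congr 1
    field_simp
    ring_nf
  rw [e]
  exact M.sub_mem (h _) (h _)

/-- Conjugation by `bor α v` scales all unipotent parameters by the same factor `α ^ 2`, whatever
`v` is, so it preserves the diagonal U. -/
theorem bor_mem_normalizer (α : Kˣ) (v : Fin n → K) (t : K) :
    ∃ s : K, w (fun _ => t) * bor α v = bor α v * w (fun _ : Fin n => s) := by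
  refine ⟨(α : K)⁻¹ ^ 2 * t, ?_⟩
  have := bor_conj_w α v (fun _ => (α : K)⁻¹ ^ 2 * t)
  rw [mul_inv_eq_iff_eq_mul] at this
  rw [this]
  congr 2
  funext j
  have : (α : K) ≠ 0 := α.ne_zero
  simp [this]

/-- Factorization of a matrix in the open cell `U⁻ B`. -/
theorem exists_low_mul (g : Matrix.SpecialLinearGroup (Fin 2) K) (h : g 0 0 ≠ 0) :
    (fun _ : Fin n => g) = (fun _ => low (g 1 0 / g 0 0)) *
      bor (Units.mk0 (g 0 0) h) (fun _ => g 0 1) := by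
  funext j
  have := sl_det g
  apply sl_ext
  · simp [sl_mul_apply]
  · simp [sl_mul_apply]
  · simp [sl_mul_apply, h]
  · simp [sl_mul_apply]
    field_simp
    linear_combination this

theorem eq_bor_const (g : Matrix.SpecialLinearGroup (Fin 2) K) (h : g 1 0 = 0) :
    ∃ α : Kˣ, (fun _ : Fin n => g) = bor α (fun _ => g 0 1) := by
  have hd := sl_det g
  have h0 : g 0 0 ≠ 0 := by
    intro h0
    simp [h, h0] at hd
  have h1 := exists_low_mul (n := n) g h0
  refine ⟨Units.mk0 (g 0 0) h0, h1.trans ?_⟩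
  funext j
  apply sl_ext <;> simp [sl_mul_apply, h]

end Algebra

/-! ### Entrywise convergence and rescaling of small vectors. -/

section Topology

variable {n : ℕ} {K : Type*} [NontriviallyNormedField K]

theorem tendsto_sl {ι : Type*} {F : Filter ι} {f : ι → Matrix.SpecialLinearGroup (Fin 2) K}
    {g : Matrix.SpecialLinearGroup (Fin 2) K}
    (h₀ : Tendsto (fun i => f i 0 0) F (𝓝 (g 0 0))) (h₁ : Tendsto (fun i => f i 0 1) F (𝓝 (g 0 1)))
    (h₂ : Tendsto (fun i => f i 1 0) F (𝓝 (g 1 0)))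
    (h₃ : Tendsto (fun i => f i 1 1) F (𝓝 (g 1 1))) : Tendsto f F (𝓝 g) := by
  refine (Topology.IsInducing.subtypeVal.tendsto_nhds_iff).2 ?_
  refine tendsto_pi_nhds.2 fun i => tendsto_pi_nhds.2 fun j => ?_
  fin_cases i <;> fin_cases j <;> assumption

theorem continuous_sl_entry (i j : Fin 2) :
    Continuous fun g : Matrix.SpecialLinearGroup (Fin 2) K => g i j :=
  (continuous_apply_apply i j).comp continuous_subtype_val

theorem continuous_entry (k : Fin n) (i j : Fin 2) : Continuous fun g : G n K => g k i j :=
  (continuous_sl_entry i j).comp (continuous_apply k)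

theorem tendsto_entry (k : Fin n) (i j : Fin 2) (g : G n K) {ι : Type*} {F : Filter ι}
    {f : ι → G n K} (h : Tendsto f F (𝓝 g)) :
    Tendsto (fun i' => f i' k i j) F (𝓝 (g k i j)) :=
  ((continuous_entry k i j).tendsto g).comp h

theorem continuous_w : Continuous (w : (Fin n → K) → G n K) := by
  refine continuous_pi fun j => ?_
  rw [continuous_iff_continuousAt]
  intro v
  apply tendsto_sl <;> simp [w_apply]
  exact (continuous_apply j).tendsto v

theorem continuous_bor : Continuous fun p : Kˣ × (Fin n → K) => bor p.1 p.2 := by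
  refine continuous_pi fun j => ?_
  rw [continuous_iff_continuousAt]
  rintro ⟨α, v⟩
  apply tendsto_sl
  · exact (Units.continuous_val.comp continuous_fst).tendsto _
  · exact ((continuous_apply j).comp continuous_snd).tendsto _
  · exact tendsto_const_nhds
  · exact (Units.continuous_val.comp (continuous_inv.comp continuous_fst)).tendsto _

/-- Two vectors, not both zero, can be rescaled by `T` and `T ^ 2` to have bounded norm while
at least one of them has norm at least one. -/
theorem exists_rescale {E F : Type*} [NormedAddCommGroup E] [NormedSpace K E]
    [NormedAddCommGroup F] [NormedSpace K F] {θ : K} (hθ : 1 < ‖θ‖) {x : E} {y : F}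
    (hx : ‖x‖ < 1) (hy : ‖y‖ < 1) (hxy : x ≠ 0 ∨ y ≠ 0) :
    ∃ T : Kˣ, (‖(T : K) • x‖ ≤ ‖θ‖ ^ 2 ∧ ‖((T : K) ^ 2) • y‖ ≤ ‖θ‖ ^ 2) ∧
      (1 ≤ ‖(T : K) • x‖ ∨ 1 ≤ ‖((T : K) ^ 2) • y‖) := by
  classical
  have hex : ∃ k : ℕ, 1 ≤ ‖(θ ^ k) • x‖ ∨ 1 ≤ ‖((θ ^ k) ^ 2) • y‖ := by
    rcases hxy with h | h
    · obtain ⟨k, hk⟩ := pow_unbounded_of_one_lt (‖x‖⁻¹) hθ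
      refine ⟨k, Or.inl ?_⟩
      have hp : 0 < ‖x‖ := norm_pos_iff.2 h
      rw [norm_smul, norm_pow]
      calc (1 : ℝ) = ‖x‖⁻¹ * ‖x‖ := by field_simp
        _ ≤ _ := by gcongr
    · obtain ⟨k, hk⟩ := pow_unbounded_of_one_lt (‖y‖⁻¹) hθ
      refine ⟨k, Or.inr ?_⟩
      have hp : 0 < ‖y‖ := norm_pos_iff.2 h
      rw [norm_smul, norm_pow, norm_pow]
      calc (1 : ℝ) = ‖y‖⁻¹ * ‖y‖ := by field_simp
        _ ≤ ‖θ‖ ^ k * ‖y‖ := by gcongr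
        _ ≤ _ := by
          gcongr
          exact le_self_pow₀ (one_le_pow₀ hθ.le) two_ne_zero
  -- At the exponent just before the least admissible one both norms are below 1; one more factor
  -- `θ` costs at most `‖θ‖ ^ 2`.
  obtain ⟨m, hm⟩ : ∃ m, Nat.find hex = m + 1 := by
    refine Nat.exists_eq_succ_of_ne_zero fun h0 => ?_
    have := Nat.find_spec hex
    rw [h0] at this
    simp only [pow_zero, one_smul, one_pow] at this
    rcases this with h | h <;> linarith
  have h1 := Nat.find_spec hex
  have h2 := Nat.find_min hex (m := m) (by omega)
  rw [hm] at h1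
  push Not at h2
  have h0 : θ ≠ 0 := by
    rintro rfl
    simp at hθ
    linarith
  refine ⟨Units.mk0 (θ ^ (m + 1)) (pow_ne_zero _ h0), ⟨?_, ?_⟩, by simpa using h1⟩
  · rw [Units.val_mk0, pow_succ', mul_smul, norm_smul]
    nlinarith [h2.1]
  · rw [Units.val_mk0, pow_succ' θ m, mul_pow, mul_smul, norm_smul, norm_pow]
    nlinarith [h2.2, norm_nonneg θ]

end Topology

/-! ### Local structure of the quotient, absence of unipotent stabilizers, and recurrence. -/

section Quotient

variable {n : ℕ} {K : Type*} [NontriviallyNormedField K] {D : Subgroup (G n K)}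

theorem map_smul_nhds_one (y : G n K ⧸ D) : map (fun g : G n K => g • y) (𝓝 1) = 𝓝 y := by
  induction y using QuotientGroup.induction_on with
  | H z =>
    rw [← QuotientGroup.isOpenQuotientMap_mk.map_nhds_eq, ← map_mul_right_nhds_one z, map_map]
    rfl

/-- Discreteness of `D`: points near `y` are not fixed by nontrivial elements near `1`. -/
theorem eventually_eq_one_of_smul_eq [DiscreteTopology D] (y : G n K ⧸ D) :
    ∀ᶠ p : G n K × G n K in 𝓝 1 ×ˢ 𝓝 1, p.1 • p.2 • y = p.2 • y → p.1 = 1 := by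
  induction y using QuotientGroup.induction_on with
  | H z =>
    obtain ⟨V, hV, hVD⟩ := isOpen_induced_iff.1 (isOpen_discrete ({1} : Set D))
    have hVD' : ∀ g ∈ V, g ∈ D → g = 1 := fun g hg hgD => by
      have h : (⟨g, hgD⟩ : D) ∈ ({1} : Set D) := by
        rw [← hVD]; exact hg
      simpa using congrArg Subtype.val (Set.mem_singleton_iff.1 h)
    have h1 : (1 : G n K) ∈ V := by
      have : (1 : D) ∈ (Subtype.val ⁻¹' V : Set D) := by rw [hVD]; rfl
      exact this
    have hc : Continuous fun p : G n K × G n K => (p.2 * z)⁻¹ * (p.1 * (p.2 * z)) := by fun_prop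
    have ht := hc.tendsto (1, 1)
    rw [nhds_prod_eq] at ht
    have hm : V ∈ 𝓝 ((1 * z)⁻¹ * (1 * (1 * z))) := hV.mem_nhds (by simpa using h1)
    filter_upwards [ht hm] with p hp hfix
    have h2 : (p.2 * z)⁻¹ * (p.1 * (p.2 * z)) ∈ D := by
      rw [← QuotientGroup.eq]
      exact hfix.symm
    have h3 := hVD' _ hp h2
    rw [inv_mul_eq_one] at h3
    exact (mul_eq_right.1 h3.symm)

theorem eventually_eq_one_of_smul_eq_self [DiscreteTopology D] (y : G n K ⧸ D) :
    ∀ᶠ g : G n K in 𝓝 1, g • y = y → g = 1 := by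
  have h := (eventually_eq_one_of_smul_eq y).curry
  filter_upwards [h] with g hg
  simpa using hg.self_of_nhds

/-- In a compact quotient every sequence of points accumulates at some `y`. -/
theorem exists_frequently_eq_smul [CompactSpace (G n K ⧸ D)] (x : ℕ → G n K ⧸ D) :
    ∃ y, ∃ᶠ p : ℕ × G n K in atTop ×ˢ 𝓝 1, x p.1 = p.2 • y := by
  obtain ⟨y, hy⟩ := exists_clusterPt_of_compactSpace (map x atTop)
  refine ⟨y, fun hn => ?_⟩
  obtain ⟨s, hs, V, hV, hsV⟩ := mem_prod_iff.1 hn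
  have hVy : (fun g : G n K => g • y) '' V ∈ 𝓝 y := by
    rw [← map_smul_nhds_one y]
    exact image_mem_map hV
  have hf : ∃ᶠ m in atTop, x m ∈ (fun g : G n K => g • y) '' V :=
    (mapClusterPt_iff_frequently.1 hy) _ hVy
  obtain ⟨m, ⟨k, hk, hkm⟩, hm⟩ := (hf.and_eventually hs).exists
  exact hsV (Set.mk_mem_prod hm hk) hkm.symm

theorem exists_unit_two_lt_norm : ∃ θ : Kˣ, 2 < ‖(θ : K)‖ := by
  obtain ⟨θ, hθ⟩ := NormedField.exists_lt_norm K 2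
  refine ⟨Units.mk0 θ ?_, hθ⟩
  rintro rfl
  simp at hθ
  linarith

theorem tendsto_inv_pow_zero {θ : K} (hθ : 1 < ‖θ‖) :
    Tendsto (fun m : ℕ => (θ⁻¹) ^ m) atTop (𝓝 0) := by
  apply tendsto_pow_atTop_nhds_zero_of_norm_lt_one
  rw [norm_inv]
  exact inv_lt_one_of_one_lt₀ hθ

/-- Points of a compact quotient by a discrete group are not fixed by unipotents. -/
theorem eq_zero_of_w_smul_eq [DiscreteTopology D] [CompactSpace (G n K ⧸ D)] (x : G n K ⧸ D)
    (v : Fin n → K) (h : w v • x = x) : v = 0 := by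
  obtain ⟨θ, hθ⟩ := exists_unit_two_lt_norm (K := K)
  -- The contracting torus moves `x` to points accumulating at `y`, while conjugating `w v` to
  -- elements that fix these points and tend to 1. Discreteness near `y` makes them trivial.
  obtain ⟨y, hy⟩ := exists_frequently_eq_smul fun m : ℕ => bor ((θ⁻¹) ^ m) (0 : Fin n → K) • x
  have hlim : Tendsto (fun m : ℕ => w (((((θ⁻¹) ^ m : Kˣ) : K) ^ 2) • v)) atTop (𝓝 1) := by
    rw [← w_zero]
    refine (continuous_w.tendsto 0).comp ?_
    have h0 := (((tendsto_inv_pow_zero (θ := (θ : K)) (by linarith)).pow 2).smul_const v)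
    simpa using h0
  have hev := (hlim.prodMap tendsto_id).eventually (eventually_eq_one_of_smul_eq y)
  obtain ⟨⟨m, k⟩, hmk, hm⟩ := (hy.and_eventually hev).exists
  have h1 := hm (by
    change w _ • k • y = k • y
    rw [← hmk, ← bor_conj_w _ 0, mul_smul, mul_smul, inv_smul_smul, h])
  have h2 := w_injective (h1.trans w_zero.symm)
  simpa using h2

theorem frequently_return [CompactSpace (G n K ⧸ D)] (x : G n K ⧸ D) :
    ∃ᶠ h : G n K in 𝓝 1, ∃ t t' : K, 1 ≤ ‖t' - t‖ ∧
      h • w (fun _ : Fin n => t) • x = w (fun _ : Fin n => t') • x := by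
  obtain ⟨θ, hθ⟩ := exists_unit_two_lt_norm (K := K)
  -- Since `‖θ‖ > 2`, distinct times `θ ^ m` are at distance at least 1, so the returns found below
  -- are not trivial.
  obtain ⟨y, hy⟩ := exists_frequently_eq_smul fun m : ℕ => w (fun _ : Fin n => (θ : K) ^ m) • x
  rw [frequently_iff]
  intro O hO
  have hc : Continuous fun p : G n K × G n K => p.2 * p.1⁻¹ := by fun_prop
  have ht := hc.tendsto (1, 1)
  rw [nhds_prod_eq] at ht
  obtain ⟨V, hV, W, hW, hVW⟩ := mem_prod_iff.1 (ht (by simpa using hO : O ∈ _))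
  obtain ⟨⟨m, k⟩, hmk, hk⟩ :=
    (hy.and_eventually (tendsto_snd.eventually_mem hV)).exists
  obtain ⟨⟨l, k'⟩, hlk, hk', hl⟩ :=
    (hy.and_eventually ((tendsto_snd.eventually_mem hW).and
      (tendsto_fst.eventually (eventually_gt_atTop m)))).exists
  refine ⟨k' * k⁻¹, hVW (Set.mk_mem_prod hk hk'), (θ : K) ^ m, (θ : K) ^ l, ?_, ?_⟩
  · obtain ⟨d, rfl⟩ := Nat.exists_eq_add_of_lt (show m < l from hl)
    have e : (θ : K) ^ (m + d + 1) - (θ : K) ^ m = (θ : K) ^ m * ((θ : K) ^ (d + 1) - 1) := by ring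
    have h1 : (1 : ℝ) ≤ ‖(θ : K)‖ := by linarith
    have h2 : 2 ≤ ‖(θ : K)‖ ^ (d + 1) := by
      calc (2 : ℝ) ≤ ‖(θ : K)‖ := hθ.le
        _ ≤ _ := le_self_pow₀ h1 (by omega)
    have h3 : 1 ≤ ‖(θ : K) ^ (d + 1) - 1‖ := by
      have := norm_sub_norm_le ((θ : K) ^ (d + 1)) 1
      rw [norm_pow, norm_one] at this
      linarith
    rw [e, norm_mul, norm_pow]
    exact one_le_mul_of_one_le_of_one_le (one_le_pow₀ h1) h3
  · change _ = k • y at hmk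
    change _ = k' • y at hlk
    rw [hmk, hlk, mul_smul, inv_smul_smul]

end Quotient

/-! ### Return elements of a minimal set. -/

section Returns

variable {n : ℕ} {K : Type*} [NontriviallyNormedField K] {D : Subgroup (G n K)}

/-- The set of elements of `G` that move some point of `X` to a point of `X`. -/
def returns (X : Set (G n K ⧸ D)) : Set (G n K) := {g | ∃ x ∈ X, g • x ∈ X}

theorem isClosed_returns [CompactSpace (G n K ⧸ D)] {X : Set (G n K ⧸ D)} (hX : IsClosed X) :
    IsClosed (returns X) := by
  have hc : IsClosed {p : G n K × (G n K ⧸ D) | p.2 ∈ X ∧ p.1 • p.2 ∈ X} :=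
    (hX.preimage continuous_snd).inter (hX.preimage (continuous_fst.smul continuous_snd))
  convert isClosedMap_fst_of_compactSpace _ hc using 1
  ext g
  simp [returns]

theorem mul_mem_returns {X : Set (G n K ⧸ D)} {g a b : G n K}
    (ha : a ∈ MulAction.stabilizer (G n K) X) (hb : b ∈ MulAction.stabilizer (G n K) X)
    (hg : g ∈ returns X) : a * g * b ∈ returns X := by
  obtain ⟨x, hx, hgx⟩ := hg
  refine ⟨b⁻¹ • x, ?_, ?_⟩
  · rw [← MulAction.mem_stabilizer_iff.1 hb] at hx
    exact Set.mem_smul_set_iff_inv_smul_mem.1 hx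
  · rw [mul_smul, smul_inv_smul, mul_smul, ← MulAction.mem_stabilizer_iff.1 ha]
    exact Set.smul_mem_smul_set hgx

theorem smul_mem_of_mem_stabilizer {X : Set (G n K ⧸ D)} {g : G n K}
    (hg : g ∈ MulAction.stabilizer (G n K) X) {x : G n K ⧸ D} (hx : x ∈ X) : g • x ∈ X := by
  rw [← MulAction.mem_stabilizer_iff.1 hg]
  exact Set.smul_mem_smul_set hx

variable {X : Set (G n K ⧸ D)}

/-- Because `bor α v` normalizes U, the intersection of X with its translate is again U-invariant,
and minimality applies. -/
theorem IsMinimalSet.subset_smul (hX : IsMinimalSet (U n K) X) {α : Kˣ} {v : Fin n → K}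
    (h : bor α v ∈ returns X) : X ⊆ bor α v • X := by
  obtain ⟨x, hx, hgx⟩ := h
  have := hX.2.2.2 (X ∩ bor α v • X) Set.inter_subset_left ⟨_, hgx, Set.smul_mem_smul_set hx⟩
    (hX.2.1.inter (hX.2.1.smul _)) (by
      rintro _ ⟨t, rfl⟩ _ ⟨hz, z, hzX, rfl⟩
      refine ⟨hX.2.2.1 _ ⟨t, rfl⟩ _ hz, ?_⟩
      obtain ⟨s, hs⟩ := bor_mem_normalizer α v t
      change w (fun _ => t) • bor α v • z ∈ _
      rw [← mul_smul, hs, mul_smul]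
      exact Set.smul_mem_smul_set (hX.2.2.1 _ ⟨s, rfl⟩ _ hzX))
  exact Set.inter_eq_left.1 this

theorem IsMinimalSet.bor_mem_stabilizer (hX : IsMinimalSet (U n K) X) {α : Kˣ} {v : Fin n → K}
    (h : bor α v ∈ returns X) : bor α v ∈ MulAction.stabilizer (G n K) X := by
  refine MulAction.mem_stabilizer_iff.2 (Set.Subset.antisymm ?_ (hX.subset_smul h))
  have h' : bor α⁻¹ (-v) ∈ returns X := by
    rw [← bor_inv]
    obtain ⟨x, hx, hgx⟩ := h
    exact ⟨_, hgx, by rwa [inv_smul_smul]⟩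
  have := hX.subset_smul h'
  rw [← bor_inv] at this
  rwa [Set.subset_smul_set_iff, inv_inv] at this

theorem IsMinimalSet.w_mem_stabilizer (hX : IsMinimalSet (U n K) X) (t : K) :
    w (fun _ => t) ∈ MulAction.stabilizer (G n K) X := by
  rw [← bor_one]
  refine hX.bor_mem_stabilizer ?_
  obtain ⟨x, hx⟩ := hX.1
  exact ⟨x, hx, by rw [bor_one]; exact hX.2.2.1 _ ⟨t, rfl⟩ _ hx⟩

/-- The orbits in a minimal set are dense. -/
theorem IsMinimalSet.subset_closure_orbit (hX : IsMinimalSet (U n K) X) {x : G n K ⧸ D}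
    (hx : x ∈ X) : X ⊆ closure {y | ∃ t : K, y = w (fun _ : Fin n => t) • x} := by
  set O := {y | ∃ t : K, y = w (fun _ : Fin n => t) • x}
  have hO : O ⊆ X := by
    rintro _ ⟨t, rfl⟩
    exact hX.2.2.1 _ ⟨t, rfl⟩ _ hx
  refine (hX.2.2.2 (closure O) (closure_minimal hO hX.2.1) ⟨x, subset_closure ⟨0, ?_⟩⟩
    isClosed_closure ?_).ge
  · change x = w (0 : Fin n → K) • x
    rw [w_zero, one_smul]
  · rintro _ ⟨t, rfl⟩ y hy
    have hm : Set.MapsTo (fun y => w (fun _ : Fin n => t) • y) O O := by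
      rintro _ ⟨s, rfl⟩
      refine ⟨t + s, ?_⟩
      change w (fun _ => t) • w (fun _ => s) • x = _
      rw [← mul_smul, ← w_add]
      rfl
    exact hm.closure (continuous_const_smul _) hy

/-- A compact `U`-invariant set returns close to itself in directions outside the group of
the elements `bor α v`. -/
theorem one_mem_closure_returns_diff [CharZero K] (hn : 1 ≤ n) [DiscreteTopology D]
    [CompactSpace (G n K ⧸ D)] (hX : IsMinimalSet (U n K) X) :
    (1 : G n K) ∈ closure (returns X \ {g | ∃ α v, g = bor α v}) := by
  rw [mem_closure_iff_frequently]
  intro hnot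
  obtain ⟨x, hx⟩ := hX.1
  have i₀ : Fin n := ⟨0, hn⟩
  have hev : ∀ᶠ h : G n K in 𝓝 1, h ∈ returns X → ∃ α v, h = bor α v := by
    filter_upwards [hnot] with h hh hr
    by_contra hc
    exact hh ⟨hr, hc⟩
  -- a returning element close to `1` gives an element fixing `x`
  have key : ∃ᶠ h : G n K in 𝓝 1, ∃ (t t' : K) (α : Kˣ) (v : Fin n → K), 1 ≤ ‖t' - t‖ ∧
      h = w (fun _ => t') * bor α v * (w fun _ => t)⁻¹ ∧ bor α v • x = x := by
    refine ((frequently_return x).and_eventually hev).mono ?_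
    rintro h ⟨⟨t, t', htt, hh⟩, hb⟩
    obtain ⟨α, v, rfl⟩ := hb ⟨_, hX.2.2.1 _ ⟨t, rfl⟩ _ hx, hh ▸ hX.2.2.1 _ ⟨t', rfl⟩ _ hx⟩
    have e : (w (fun _ : Fin n => t'))⁻¹ * bor α v * w (fun _ => t) =
        bor α (fun j => α * t + (v j + -t' * (α : K)⁻¹)) := by
      rw [← w_neg, ← bor_one, ← bor_one, bor_mul, bor_mul]
      congr 1
      · simp
      · funext j
        simp
    refine ⟨t, t', α, fun j => α * t + (v j + -t' * (α : K)⁻¹), htt, ?_, ?_⟩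
    · rw [← e]
      group
    · rw [← e, mul_smul, mul_smul, hh, inv_smul_smul]
  have hα0 : ∀ (t t' : K) (α : Kˣ) (v : Fin n → K),
      (w (fun _ => t') * bor α v * (w fun _ => t)⁻¹ : G n K) i₀ 0 0 = α := by
    intro t t' α v
    rw [← w_neg]
    simp [sl_mul_apply, w_apply]
  have h01 : ∀ᶠ h : G n K in 𝓝 1, ‖h i₀ 0 1‖ < 1 :=
    (tendsto_entry i₀ 0 1 (1 : G n K) tendsto_id).norm.eventually_lt_const (by simp)
  -- If the fixing element were 1, then `h` would be unipotent with parameter `t' - t` of norm at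
  -- least 1, hence not close to 1.
  have hnt : ∀ᶠ h : G n K in 𝓝 1, ∀ (t t' : K) (α : Kˣ) (v : Fin n → K), 1 ≤ ‖t' - t‖ →
      h = w (fun _ => t') * bor α v * (w fun _ => t)⁻¹ → bor α v ≠ 1 := by
    filter_upwards [h01] with h hh t t' α v htt he h1
    rw [he, h1, ← w_neg, mul_one, ← w_add] at hh
    simp [w_apply] at hh
    rw [← sub_eq_add_neg] at hh
    linarith
  have hsq : ∀ᶠ h : G n K in 𝓝 1, h i₀ 0 0 ≠ -1 := by
    refine (tendsto_entry i₀ 0 0 (1 : G n K) tendsto_id).eventually_ne ?_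
    simp
    norm_num [eq_neg_iff_add_eq_zero]
  obtain ⟨h₁, ⟨t₁, t₁', α, v, htt₁, he₁, hfix₁⟩, hnt₁, hsq₁⟩ :=
    (key.and_eventually (hnt.and hsq)).exists
  have hα : (α : K) = h₁ i₀ 0 0 := by rw [he₁, hα0]
  have hα1 : (α : K) - (α : K)⁻¹ ≠ 0 := by
    intro h0
    have hs : (α : K) ^ 2 = 1 := by
      have := α.ne_zero
      field_simp at h0
      linear_combination h0
    rcases sq_eq_one_iff.1 hs with h | h
    · obtain rfl : α = 1 := Units.ext h
      rw [bor_one] at hfix₁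
      refine hnt₁ _ _ _ _ htt₁ he₁ ?_
      rw [bor_one, eq_zero_of_w_smul_eq x v hfix₁, w_zero]
    · exact hsq₁ (hα ▸ h)
  -- elements fixing `x` commute, so their diagonal determines them
  have hcomm : ∀ (β : Kˣ) (u : Fin n → K), bor β u • x = x →
      u = (((β : K) - (β : K)⁻¹) / (α - (α : K)⁻¹)) • v := by
    intro β u hfix
    have hw : w (fun j => (α * β : K) * ((α - (α : K)⁻¹) * u j - (β - (β : K)⁻¹) * v j)) • x
        = x := by
      rw [← bor_commutator, mul_smul, inv_smul_eq_iff.2, mul_smul, hfix, hfix₁]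
      rw [mul_smul, hfix₁, hfix]
    funext j
    have h0 := congrFun (eq_zero_of_w_smul_eq x _ hw) j
    simp only [Pi.zero_apply, mul_eq_zero, Units.ne_zero, or_self, false_or] at h0
    rw [Pi.smul_apply, smul_eq_mul]
    rw [div_mul_eq_mul_div, eq_div_iff hα1]
    linear_combination h0
  -- A fixing element is a continuous function of its diagonal `β`, with value 1 at `β = 1`. Thus it
  -- is near 1 as soon as `β` is, even if `t` and `t'` are large, and discreteness makes it trivial.
  have hsmall : ∀ᶠ β : Kˣ in 𝓝 1,
      bor β ((((β : K) - (β : K)⁻¹) / (α - (α : K)⁻¹)) • v) • x = x →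
      bor β ((((β : K) - (β : K)⁻¹) / (α - (α : K)⁻¹)) • v) = 1 := by
    have hc : Continuous fun β : Kˣ =>
        bor β ((((β : K) - ((β⁻¹ : Kˣ) : K)) / (α - (α : K)⁻¹)) • v) := by
      have h1 : Continuous fun β : Kˣ => ((β : K) - ((β⁻¹ : Kˣ) : K)) / (α - (α : K)⁻¹) :=
        (Units.continuous_val.sub (Units.continuous_val.comp continuous_inv)).div_const _
      have h2 : Continuous fun β : Kˣ =>
          (((β : K) - ((β⁻¹ : Kˣ) : K)) / (α - (α : K)⁻¹)) • v := h1.smul continuous_const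
      exact continuous_bor.comp (continuous_id.prodMk h2)
    have ht := hc.tendsto 1
    simp only [Units.val_inv_eq_inv_val] at ht
    rw [show bor 1 _ = (1 : G n K) by rw [bor_one, ← w_zero]; simp] at ht
    exact ht.eventually (eventually_eq_one_of_smul_eq_self x)
  rw [Units.isEmbedding_val₀.isInducing.nhds_eq_comap, eventually_comap] at hsmall
  have hsmall' := (tendsto_entry i₀ 0 0 (1 : G n K) tendsto_id).eventually (by simpa using hsmall)
  obtain ⟨h, ⟨t, t', β, u, htt, he, hfix⟩, hnt, hs⟩ :=
    (key.and_eventually (hnt.and hsmall')).exists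
  refine hnt _ _ _ _ htt he ?_
  have hu := hcomm β u hfix
  rw [hu] at hfix ⊢
  refine hs β ?_ hfix
  rw [id, he, hα0]

end Returns

/-! ### Shearing close returns along U and the resulting limit curves. -/

section Limits

variable {n : ℕ} {K : Type*} [NontriviallyNormedField K]

theorem exists_tendsto_of_norm_le {E ι : Type*} [NormedAddCommGroup E] [ProperSpace E]
    (F : Ultrafilter ι) (f : ι → E) (C : ℝ) (h : ∀ᶠ i in (F : Filter ι), ‖f i‖ ≤ C) :
    ∃ a, Tendsto f F (𝓝 a) := by
  obtain ⟨a, -, ha⟩ := (isCompact_closedBall (0 : E) C).ultrafilter_le_nhds (F.map f) (by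
    rw [le_principal_iff]
    exact h.mono fun i hi => by simpa using hi)
  exact ⟨a, ha⟩

/-- The limit of rescaled vectors as in `exists_rescale`. -/
theorem exists_tendsto_rescale {E E' ι : Type*} [NormedAddCommGroup E] [NormedSpace K E]
    [NormedAddCommGroup E'] [NormedSpace K E'] [ProperSpace E] [ProperSpace E']
    (F : Ultrafilter ι) {x : ι → E} {y : ι → E'} (hx : Tendsto x F (𝓝 0))
    (hy : Tendsto y F (𝓝 0)) (hxy : ∀ᶠ i in (F : Filter ι), x i ≠ 0 ∨ y i ≠ 0) :
    ∃ (T : ι → Kˣ) (a : E) (b : E'), (a ≠ 0 ∨ b ≠ 0) ∧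
      Tendsto (fun i => ((T i : K))⁻¹) F (𝓝 0) ∧
      Tendsto (fun i => (T i : K) • x i) F (𝓝 a) ∧
      Tendsto (fun i => ((T i : K) ^ 2) • y i) F (𝓝 b) := by
  obtain ⟨θ, hθ⟩ := NormedField.exists_one_lt_norm K
  have hx1 := hx.norm.eventually_lt_const (u := 1) (by simp)
  have hy1 := hy.norm.eventually_lt_const (u := 1) (by simp)
  have hex : ∀ᶠ i in (F : Filter ι), ∃ T : Kˣ,
      (‖(T : K) • x i‖ ≤ ‖θ‖ ^ 2 ∧ ‖((T : K) ^ 2) • y i‖ ≤ ‖θ‖ ^ 2) ∧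
      (1 ≤ ‖(T : K) • x i‖ ∨ 1 ≤ ‖((T : K) ^ 2) • y i‖) := by
    filter_upwards [hx1, hy1, hxy] with i h1 h2 h3
    exact exists_rescale hθ h1 h2 h3
  obtain ⟨T, hT⟩ := hex.choice
  obtain ⟨a, ha⟩ := exists_tendsto_of_norm_le F (fun i => (T i : K) • x i) _
    (hT.mono fun i h => h.1.1)
  obtain ⟨b, hb⟩ := exists_tendsto_of_norm_le F (fun i => ((T i : K) ^ 2) • y i) _
    (hT.mono fun i h => h.1.2)
  refine ⟨T, a, b, ?_, ?_, ha, hb⟩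
  · rcases Ultrafilter.eventually_or.1 (hT.mono fun i h => h.2) with h | h
    · left
      rintro rfl
      have := ge_of_tendsto ha.norm h
      norm_num at this
    · right
      rintro rfl
      have := ge_of_tendsto hb.norm h
      norm_num at this
  · have h0 : Tendsto (fun i => ‖x i‖ ^ 2 + ‖y i‖) F (𝓝 0) := by
      have := (hx.norm.pow 2).add hy.norm
      simpa using this
    have h2 : Tendsto (fun i => ‖((T i : K))⁻¹‖ ^ 2) F (𝓝 0) := by
      refine squeeze_zero' (Eventually.of_forall fun i => by positivity) ?_ h0
      filter_upwards [hT] with i hi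
      have hp : 0 < ‖(T i : K)‖ := norm_pos_iff.2 (T i).ne_zero
      rw [norm_inv, inv_pow, inv_le_iff_one_le_mul₀ (by positivity)]
      rcases hi.2 with h | h
      · rw [norm_smul] at h
        have h' : 1 ≤ (‖(T i : K)‖ * ‖x i‖) ^ 2 := one_le_pow₀ h
        have := mul_nonneg (norm_nonneg (y i)) (sq_nonneg ‖(T i : K)‖)
        nlinarith
      · rw [norm_smul, norm_pow] at h
        have := mul_nonneg (sq_nonneg ‖x i‖) (sq_nonneg ‖(T i : K)‖)
        nlinarith
    rw [tendsto_zero_iff_norm_tendsto_zero]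
    have h3 := h2.sqrt
    simpa using h3

variable [CharZero K]

/-- Matrices near `1` outside the group of the `bor α v`, moved along `U` on both sides, have
limits tracing a nonconstant curve of elements `bor α v`. -/
theorem exists_limit_curve [LocallyCompactSpace K] (l : Fin n) {R : Set (G n K)} (hR : IsClosed R)
    (hU : ∀ g ∈ R, ∀ s t : K, w (fun _ => s) * g * w (fun _ => t) ∈ R)
    (h1 : (1 : G n K) ∈ closure (R \ {g | ∃ α v, g = bor α v})) :
    ∃ (γ : K) (p q : Fin n → K), p l = 0 ∧ q l = 0 ∧ (γ ≠ 0 ∨ p ≠ 0 ∨ q ≠ 0) ∧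
      ∀ (τ : K) (α : Kˣ), (α : K) = 1 + τ * γ →
        bor α ((α : K)⁻¹ • (τ • p + (τ ^ 2) • q)) ∈ R := by
  have : ProperSpace K := ProperSpace.of_locallyCompactSpace K
  have : NeBot (𝓝 (1 : G n K) ⊓ 𝓟 (R \ {g | ∃ α v, g = bor α v})) :=
    mem_closure_iff_clusterPt.1 h1
  set F := Ultrafilter.of (𝓝 (1 : G n K) ⊓ 𝓟 (R \ {g | ∃ α v, g = bor α v}))
  have hF1 : Tendsto id (F : Filter (G n K)) (𝓝 1) :=
    (Ultrafilter.of_le _).trans inf_le_left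
  have hFR : ∀ᶠ g in (F : Filter (G n K)), g ∈ R \ {g | ∃ α v, g = bor α v} :=
    (Ultrafilter.of_le _).trans inf_le_right (mem_principal_self _)
  have ha : ∀ j, Tendsto (fun g : G n K => g j 0 0) F (𝓝 1) := fun j => by
    simpa using tendsto_entry j 0 0 1 hF1
  have hb : ∀ j, Tendsto (fun g : G n K => g j 0 1) F (𝓝 0) := fun j => by
    simpa using tendsto_entry j 0 1 1 hF1
  have hc : ∀ j, Tendsto (fun g : G n K => g j 1 0) F (𝓝 0) := fun j => by
    simpa using tendsto_entry j 1 0 1 hF1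
  have hd : ∀ j, Tendsto (fun g : G n K => g j 1 1) F (𝓝 1) := fun j => by
    simpa using tendsto_entry j 1 1 1 hF1
  set c : G n K → Fin n → K := fun g j => g j 1 0 with hc_def
  -- `P` and `Q` are the coefficients of `τ * T` and `(τ * T) ^ 2` in the numerator of the upper
  -- right entry after shearing; the constant coefficient tends to 0 without rescaling.
  set P : G n K → Fin n → K := fun g j =>
    g j 0 1 * g l 1 0 + g j 1 1 * g l 0 0 - g j 0 0 * g l 1 1 - g j 1 0 * g l 0 1 with hP_def
  set Q : G n K → Fin n → K := fun g j => g j 1 1 * g l 1 0 - g j 1 0 * g l 1 1 with hQ_def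
  have hx : Tendsto (fun g => (c g, P g)) F (𝓝 0) := by
    refine Tendsto.prodMk_nhds (tendsto_pi_nhds.2 hc) (tendsto_pi_nhds.2 fun j => ?_)
    have := ((((hb j).mul (hc l)).add ((hd j).mul (ha l))).sub ((ha j).mul (hd l))).sub
      ((hc j).mul (hb l))
    simpa using this
  have hy : Tendsto Q F (𝓝 0) := by
    refine tendsto_pi_nhds.2 fun j => ?_
    have := ((hd j).mul (hc l)).sub ((hc j).mul (hd l))
    simpa using this
  have hne : ∀ᶠ g in (F : Filter (G n K)), (c g, P g) ≠ 0 ∨ Q g ≠ 0 := by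
    -- When `c` and `P` vanish, the diagonal entries agree only up to sign; closeness to 1 fixes the
    -- sign and puts `g` in B.
    have hs : ∀ᶠ g in (F : Filter (G n K)), ∀ j, g j 0 0 + g l 0 0 ≠ 0 := by
      rw [eventually_all]
      intro j
      exact ((ha j).add (ha l)).eventually_ne (by norm_num)
    filter_upwards [hFR, hs] with g hg hsum
    left
    intro h0
    rw [Prod.mk_eq_zero] at h0
    have hc0 : ∀ j, g j 1 0 = 0 := fun j => congrFun h0.1 j
    have hP0 : ∀ j, g j 0 1 * g l 1 0 + g j 1 1 * g l 0 0 - g j 0 0 * g l 1 1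
      - g j 1 0 * g l 0 1 = 0 := fun j => congrFun h0.2 j
    have hdet : ∀ j, g j 0 0 * g j 1 1 = 1 := fun j => by
      have := sl_det (g j)
      rw [hc0 j] at this
      linear_combination this
    have hane : ∀ j, g j 0 0 ≠ 0 := fun j h => by
      have := hdet j
      simp [h] at this
    have hal : ∀ j, g j 0 0 = g l 0 0 := fun j => by
      have h2 := hP0 j
      rw [hc0 j, hc0 l] at h2
      have h3 : (g j 0 0 + g l 0 0) * (g j 0 0 - g l 0 0) = 0 := by
        linear_combination (-(g j 0 0 * g l 0 0)) * h2 - (g j 0 0) ^ 2 * hdet l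
          + (g l 0 0) ^ 2 * hdet j
      exact sub_eq_zero.1 ((mul_eq_zero.1 h3).resolve_left (hsum j))
    refine hg.2 ⟨Units.mk0 (g l 0 0) (hane l), fun j => g j 0 1, ?_⟩
    funext j
    apply sl_ext
    · simp [hal j]
    · simp
    · simp [hc0 j]
    · simp only [bor_11, Units.val_mk0]
      rw [← hal j]
      exact eq_inv_of_mul_eq_one_right (hdet j)
  obtain ⟨T, ⟨γ, p⟩, q, hne0, hT, hTx, hTQ⟩ :=
    exists_tendsto_rescale (K := K) F hx hy hne
  have hTc : ∀ j, Tendsto (fun g => (T g : K) * g j 1 0) F (𝓝 (γ j)) := fun j =>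
    (((continuous_apply j).comp continuous_fst).tendsto _).comp hTx
  have hTP : ∀ j, Tendsto (fun g => (T g : K) * P g j) F (𝓝 (p j)) := fun j =>
    (((continuous_apply j).comp continuous_snd).tendsto _).comp hTx
  have hTQ' : ∀ j, Tendsto (fun g => (T g : K) ^ 2 * Q g j) F (𝓝 (q j)) := fun j =>
    ((continuous_apply j).tendsto _).comp hTQ
  -- As `T ^ 2 * Q` converges, `T * Q` tends to 0; its limit is also the difference of the two
  -- components of `γ`.
  have hγ : ∀ j, γ j = γ l := fun j => by
    have e1 : Tendsto (fun g => (T g : K)⁻¹ * ((T g : K) ^ 2 * Q g j)) F (𝓝 0) := by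
      have := hT.mul (hTQ' j)
      simpa using this
    have e2 : Tendsto (fun g => (T g : K)⁻¹ * ((T g : K) ^ 2 * Q g j)) F (𝓝 (γ l - γ j)) := by
      have := ((hd j).mul (hTc l)).sub ((hd l).mul (hTc j))
      rw [one_mul, one_mul] at this
      refine this.congr fun g => ?_
      have := (T g).ne_zero
      simp only [hQ_def]
      field_simp
    exact (sub_eq_zero.1 (tendsto_nhds_unique e2 e1)).symm
  refine ⟨γ l, p, q, ?_, ?_, ?_, ?_⟩
  · refine tendsto_nhds_unique (hTP l) (tendsto_const_nhds.congr fun g => ?_)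
    simp only [hP_def]
    ring
  · refine tendsto_nhds_unique (hTQ' l) (tendsto_const_nhds.congr fun g => ?_)
    simp only [hQ_def]
    ring
  · by_contra hcon
    push Not at hcon
    obtain ⟨h2, h3, h4⟩ := hcon
    rcases hne0 with h | h
    · refine h ?_
      rw [Prod.mk_eq_zero]
      exact ⟨funext fun j => (hγ j).trans h2, h3⟩
    · exact h h4
  · intro τ α hα
    have hα0 : (α : K) ≠ 0 := α.ne_zero
    have hA : ∀ j, Tendsto (fun g : G n K => g j 0 0 + τ * T g * g j 1 0) F (𝓝 (α : K)) := by
      intro j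
      rw [hα, ← hγ j]
      simpa [mul_assoc] using (ha j).add ((hTc j).const_mul τ)
    have hAne : ∀ᶠ g in (F : Filter (G n K)), g l 0 0 + τ * T g * g l 1 0 ≠ 0 :=
      (hA l).eventually_ne hα0
    -- This right shear makes the upper right entry of the component `l` vanish.
    set s : G n K → K := fun g =>
      (g l 0 1 + τ * T g * g l 1 1) / (g l 0 0 + τ * T g * g l 1 0) with hs_def
    refine hR.mem_of_tendsto (f := fun g => w (fun _ => τ * T g) * g * w (fun _ => -s g))
      (b := (F : Filter (G n K))) ?_ (hFR.mono fun g hg => hU g hg.1 _ _)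
    refine tendsto_pi_nhds.2 fun j => tendsto_sl ?_ ?_ ?_ ?_
    · simp [sl_mul_apply, w_apply]
      exact hA j
    · have hlim : Tendsto (fun g : G n K => ((g j 0 1 * g l 0 0 - g j 0 0 * g l 0 1)
          + τ * ((T g : K) * P g j) + τ ^ 2 * ((T g : K) ^ 2 * Q g j)) /
          (g l 0 0 + τ * T g * g l 1 0)) F (𝓝 ((α : K)⁻¹ * (τ * p j + τ ^ 2 * q j))) := by
        have := (((((hb j).mul (ha l)).sub ((ha j).mul (hb l))).add
          ((hTP j).const_mul τ)).add ((hTQ' j).const_mul (τ ^ 2))).div (hA l) hα0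
        rw [zero_mul, mul_zero, sub_zero, zero_add] at this
        rwa [inv_mul_eq_div]
      simp only [bor_01, Pi.smul_apply, Pi.add_apply, smul_eq_mul]
      refine hlim.congr' ?_
      filter_upwards [hAne] with g hg
      simp [sl_mul_apply, w_apply, hs_def, hP_def, hQ_def]
      field_simp
      ring
    · simp [sl_mul_apply, w_apply]
      exact hc j
    · have hlim : Tendsto (fun g : G n K => g j 1 1 - (g j 1 0 * g l 0 1
          + τ * ((T g : K) * g j 1 0) * g l 1 1) / (g l 0 0 + τ * T g * g l 1 0)) F
          (𝓝 ((α : K)⁻¹)) := by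
        have := (hd j).sub ((((hc j).mul (hb l)).add
          (((hTc j).const_mul τ).mul (hd l))).div (hA l) hα0)
        have e : (1 : K) - (0 * 0 + τ * γ j * 1) / α = (α : K)⁻¹ := by
          rw [hγ j]
          field_simp
          linear_combination hα
        rwa [e] at this
      rw [bor_11]
      refine hlim.congr fun g => ?_
      simp [sl_mul_apply, w_apply, hs_def]
      ring

/-- Conjugation gives all square multiples of `v`, and differences of squares exhaust K. -/
theorem w_smul_mem {S : Subgroup (G n K)} (hS : ∀ α : Kˣ, ∃ r, bor α r ∈ S) {v : Fin n → K}
    (hv : w v ∈ S) (s : K) : w (s • v) ∈ S := by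
  let M : AddSubgroup (Fin n → K) :=
    { carrier := {u | w u ∈ S}
      zero_mem' := by simp [w_zero, S.one_mem]
      add_mem' := fun {a b} ha hb => by
        simpa only [Set.mem_ofPred_eq, w_add] using S.mul_mem ha hb
      neg_mem' := fun {a} ha => by
        simpa only [Set.mem_ofPred_eq, w_neg] using S.inv_mem ha }
  refine mem_of_sq_smul_mem M v (fun α => ?_) s
  obtain ⟨r, hr⟩ := hS α
  change w _ ∈ S
  rw [← bor_conj_w α r]
  exact S.mul_mem (S.mul_mem hr hv) (S.inv_mem hr)

/-- The returning elements contain a line of `U^⊥`, or a conjugate of the diagonal torus. -/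
theorem line_or_torus_of_curve (l : Fin n) {S : Subgroup (G n K)} {γ : K} {p q : Fin n → K}
    (hp : p l = 0) (hq : q l = 0) (h0 : γ ≠ 0 ∨ p ≠ 0 ∨ q ≠ 0)
    (hS : ∀ (τ : K) (α : Kˣ), (α : K) = 1 + τ * γ →
        bor α ((α : K)⁻¹ • (τ • p + (τ ^ 2) • q)) ∈ S) :
    (∃ v : Fin n → K, v ≠ 0 ∧ v l = 0 ∧ ∀ s : K, w (s • v) ∈ S) ∨
      ∃ z : Fin n → K, z l = 0 ∧ ∀ α : Kˣ, w z * bor α 0 * (w z)⁻¹ ∈ S := by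
  have h2 : (2 : K) ≠ 0 := two_ne_zero
  by_cases hγ : γ = 0
  · left
    have hw : ∀ τ : K, w (τ • p + (τ ^ 2) • q) ∈ S := fun τ => by
      have := hS τ 1 (by simp [hγ])
      simpa [bor_one] using this
    by_cases hq0 : q = 0
    · refine ⟨p, ?_, hp, fun s => by simpa [hq0] using hw s⟩
      rcases h0 with h | h | h
      · exact absurd hγ h
      · exact h
      · exact absurd hq0 h
    · refine ⟨q, hq0, hq, fun s => ?_⟩
      -- With `f τ = τ p + τ² q`, one has `f (σ + 1) - f σ - f 1 = 2 σ q`; here `σ = s / 2`.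
      have e : w (s • q) = w ((s / 2 + 1) • p + ((s / 2 + 1) ^ 2) • q) *
          (w ((s / 2) • p + ((s / 2) ^ 2) • q))⁻¹ * (w ((1 : K) • p + ((1 : K) ^ 2) • q))⁻¹ := by
        rw [← w_neg, ← w_neg, ← w_add, ← w_add]
        congr 1
        funext j
        simp
        field_simp
        ring
      rw [e]
      exact S.mul_mem (S.mul_mem (hw _) (S.inv_mem (hw _))) (S.inv_mem (hw _))
  · have hα : ∀ α : Kˣ, ∃ r : Fin n → K, r l = 0 ∧ bor α r ∈ S := fun α => by
      refine ⟨_, ?_, hS (((α : K) - 1) / γ) α (by field_simp; ring)⟩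
      simp [hp, hq]
    by_cases hM : ∃ v : Fin n → K, v ≠ 0 ∧ v l = 0 ∧ w v ∈ S
    · left
      obtain ⟨v, hv, hvl, hvS⟩ := hM
      exact ⟨v, hv, hvl, w_smul_mem (fun α => (hα α).imp fun _ h => h.2) hvS⟩
    · right
      push Not at hM
      -- The value 2 serves because its square is not 1, so this element is conjugate by some `w z`
      -- to a diagonal one. Commutators are unipotent with vanishing coordinate `l`, hence trivial
      -- here, and commuting with this element forces every `bor α u` found into the same conjugate
      -- torus.
      obtain ⟨r, hrl, hr⟩ := hα (Units.mk0 2 h2)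
      have h3 : ((2 : K)⁻¹ - 2) ≠ 0 := by
        intro h
        field_simp at h
        norm_num at h
      refine ⟨((2 : K)⁻¹ - 2)⁻¹ • r, by simp [hrl], fun α => ?_⟩
      obtain ⟨u, hul, hu⟩ := hα α
      have hcomm := S.mul_mem (S.mul_mem hr hu) (S.inv_mem (S.mul_mem hu hr))
      rw [bor_commutator] at hcomm
      have hzero := not_imp_not.1 (fun h => hM _ h (by simp [hul, hrl])) hcomm
      rw [w_conj_bor]
      convert hu using 2
      funext j
      have hj := congrFun hzero j
      rw [Pi.zero_apply, Units.val_mk0] at hj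
      replace hj := (mul_eq_zero.1 hj).resolve_left (mul_ne_zero h2 α.ne_zero)
      rw [Pi.smul_apply, smul_eq_mul, ← mul_assoc, mul_comm _ (_⁻¹), mul_assoc,
        inv_mul_eq_iff_eq_mul₀ h3]
      linear_combination hj

end Limits

/-! ### Expansion of returns transverse to H by the torus. -/

section Torus

variable {n : ℕ} {K : Type*} [NontriviallyNormedField K]

theorem bor_const_mem {S : Subgroup (G n K)} (hw : ∀ t : K, w (fun _ => t) ∈ S)
    (hA : ∀ α : Kˣ, bor α 0 ∈ S) (α : Kˣ) (t : K) : bor α (fun _ => t) ∈ S := by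
  have h := S.mul_mem (hA α) (hw ((α : K)⁻¹ * t))
  rw [← bor_one, bor_mul] at h
  convert h using 2
  · simp
  · simp

theorem bor_mul_low (α : Kˣ) (r : K) :
    (fun _ : Fin n => low ((α : K)⁻¹ ^ 2 * r)) * bor α 0 = bor α 0 * fun _ => low r := by
  funext j
  have := α.ne_zero
  apply sl_ext <;> simp [sl_mul_apply]
  field_simp

theorem weyl_conj_bor (α : Kˣ) :
    bor α 0 * (fun _ : Fin n => weyl) * bor α 0 = fun _ => weyl := by
  funext j
  apply sl_ext <;> simp [sl_mul_apply]

/-- When the torus stabilizes, returns close to `1` outside `H` produce a line. -/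
theorem line_of_one_mem_closure_diff [LocallyCompactSpace K] [CharZero K] (l : Fin n)
    {R : Set (G n K)} (hR : IsClosed R) {S : Subgroup (G n K)}
    (hRS : ∀ a ∈ S, ∀ b ∈ S, ∀ g ∈ R, a * g * b ∈ R) (hw : ∀ t : K, w (fun _ => t) ∈ S)
    (hA : ∀ α : Kˣ, bor α 0 ∈ S) (hN : ∀ α v, bor α v ∈ R → bor α v ∈ S)
    (h1 : (1 : G n K) ∈ closure (R \ H n K)) :
    ∃ v : Fin n → K, v ≠ 0 ∧ v l = 0 ∧ ∀ s : K, w (s • v) ∈ S := by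
  have : ProperSpace K := ProperSpace.of_locallyCompactSpace K
  have : NeBot (𝓝 (1 : G n K) ⊓ 𝓟 (R \ H n K)) := mem_closure_iff_clusterPt.1 h1
  set F := Ultrafilter.of (𝓝 (1 : G n K) ⊓ 𝓟 (R \ H n K))
  have hF1 : Tendsto id (F : Filter (G n K)) (𝓝 1) := (Ultrafilter.of_le _).trans inf_le_left
  have hFR : ∀ᶠ g in (F : Filter (G n K)), g ∈ R \ H n K :=
    (Ultrafilter.of_le _).trans inf_le_right (mem_principal_self _)
  -- This removes the H-part: `g'` is trivial in the component `l`, and equals 1 only for `g` in H.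
  set g' : G n K → G n K := fun g => g * (fun _ => g l)⁻¹ with hg'
  have hgl : Tendsto (fun g : G n K => g l) F (𝓝 1) := ((continuous_apply l).tendsto _).comp hF1
  have hF1' : Tendsto g' (F : Filter (G n K)) (𝓝 1) := by
    have h2 : Tendsto (fun g : G n K => (fun _ : Fin n => g l)) F (𝓝 1) :=
      tendsto_pi_nhds.2 fun _ => hgl
    simpa using hF1.mul h2.inv
  have ha : ∀ j, Tendsto (fun g : G n K => g' g j 0 0) F (𝓝 1) := fun j => by
    simpa using tendsto_entry j 0 0 1 hF1'
  have hb : ∀ j, Tendsto (fun g : G n K => g' g j 0 1) F (𝓝 0) := fun j => by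
    simpa using tendsto_entry j 0 1 1 hF1'
  have hc : ∀ j, Tendsto (fun g : G n K => g' g j 1 0) F (𝓝 0) := fun j => by
    simpa using tendsto_entry j 1 0 1 hF1'
  have hd : ∀ j, Tendsto (fun g : G n K => g' g j 1 1) F (𝓝 1) := fun j => by
    simpa using tendsto_entry j 1 1 1 hF1'
  -- `V t g` collects the upper right entries of `w (t, …, t) * g' * w (-t, …, -t)`. They are
  -- quadratic in `t`; if they vanish at 0, 1 and -1, each component of `g'` is scalar, hence 1 when
  -- close to 1.
  set V : K → G n K → Fin n → K := fun t g j =>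
    g' g j 0 1 + t * (g' g j 1 1 - g' g j 0 0) - t ^ 2 * g' g j 1 0 with hV_def
  have hV : ∀ t, Tendsto (V t) F (𝓝 0) := fun t => tendsto_pi_nhds.2 fun j => by
    have := ((hb j).add (((hd j).sub (ha j)).const_mul t)).sub ((hc j).const_mul (t ^ 2))
    simpa using this
  have hVl : ∀ t g, V t g l = 0 := fun t g => by
    have : g' g l = 1 := by simp [hg']
    simp [hV_def, this]
  obtain ⟨t, ht⟩ : ∃ t, ∀ᶠ g in (F : Filter (G n K)), V t g ≠ 0 := by
    have hs : ∀ᶠ g in (F : Filter (G n K)), ∀ j, g' g j 0 0 ≠ -1 := by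
      rw [eventually_all]
      intro j
      exact (ha j).eventually_ne (by norm_num [eq_neg_iff_add_eq_zero])
    have hor : ∀ᶠ g in (F : Filter (G n K)), V 0 g ≠ 0 ∨ V 1 g ≠ 0 ∨ V (-1) g ≠ 0 := by
      filter_upwards [hFR, hs] with g hg hs
      by_contra hcon
      push Not at hcon
      obtain ⟨h0, h1, h2⟩ := hcon
      refine hg.2 ⟨g l, ?_⟩
      have hone : g' g = 1 := by
        funext j
        have e0 := congrFun h0 j
        have e1 := congrFun h1 j
        have e2 := congrFun h2 j
        simp only [hV_def, Pi.zero_apply] at e0 e1 e2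
        have b0 : g' g j 0 1 = 0 := by linear_combination e0
        have c0 : g' g j 1 0 = 0 := by
          have : (2 : K) * g' g j 1 0 = 0 := by linear_combination 2 * e0 - e1 - e2
          simpa using this
        have d0 : g' g j 1 1 = g' g j 0 0 := by linear_combination e1 - e0 + c0
        have hdet := sl_det (g' g j)
        rw [b0, d0, zero_mul, sub_zero] at hdet
        have a0 : g' g j 0 0 = 1 := (mul_self_eq_one_iff.1 hdet).resolve_right (hs j)
        apply sl_ext <;> simp [a0, b0, c0, d0]
      exact mul_inv_eq_one.1 hone
    rcases Ultrafilter.eventually_or.1 hor with h | h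
    · exact ⟨_, h⟩
    · rcases Ultrafilter.eventually_or.1 h with h | h <;> exact ⟨_, h⟩
  -- The first vector is zero, so only the scaling by `T ^ 2` matters and its limit `v` is nonzero.
  obtain ⟨T, a, v, hav, hT, hTa, hTv⟩ := exists_tendsto_rescale (K := K) F
    (tendsto_const_nhds (x := (0 : K))) (hV t) (ht.mono fun _ h => Or.inr h)
  have hv0 : v ≠ 0 := by
    refine hav.resolve_left (not_not.2 ?_)
    simp only [smul_zero] at hTa
    exact tendsto_nhds_unique hTa tendsto_const_nhds
  have hTv' : ∀ j, Tendsto (fun g => (T g : K) ^ 2 * V t g j) F (𝓝 (v j)) := fun j =>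
    ((continuous_apply j).tendsto _).comp hTv
  have hvl : v l = 0 := by
    refine tendsto_nhds_unique (hTv' l) (tendsto_const_nhds.congr fun g => ?_)
    rw [hVl, mul_zero]
  refine ⟨v, hv0, hvl, w_smul_mem (fun α => ⟨0, hA α⟩) ?_⟩
  rw [← bor_one]
  refine hN _ _ ?_
  set k : G n K → Matrix.SpecialLinearGroup (Fin 2) K := fun g => w₁ t * g l with hk
  have hk0 : Tendsto (fun g => k g 0 0) F (𝓝 1) := by
    have h0 := ((continuous_sl_entry (K := K) 0 0).tendsto _).comp hgl
    have h1 := ((continuous_sl_entry (K := K) 1 0).tendsto _).comp hgl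
    have := h0.add (h1.const_mul t)
    simp only [Matrix.SpecialLinearGroup.coe_one] at this
    simpa [hk, sl_mul_apply, Function.comp_def] using this
  have hk1 : Tendsto (fun g => k g 1 0) F (𝓝 0) := by
    have h1 := ((continuous_sl_entry (K := K) 1 0).tendsto _).comp hgl
    simpa [hk, sl_mul_apply, Function.comp_def] using h1
  set ρ : G n K → K := fun g => k g 1 0 / k g 0 0 with hρ_def
  have hρ : Tendsto ρ F (𝓝 0) := by
    have := hk1.div hk0 one_ne_zero
    rwa [zero_div] at this
  -- The factor `low (ρ g)` differs from the diagonal `w₁ t * g l` by a triangular element of S, so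
  -- `e g` stays in R. Conjugation by `bor (T g) 0` contracts lower left entries and expands `V` by
  -- `T ^ 2`, so the limit is `w v`.
  set e : G n K → G n K := fun g =>
    bor (T g) 0 * w (fun _ => t) * g' g * w (fun _ => -t) * (fun _ => low (ρ g)) *
      bor (T g)⁻¹ 0 with he
  have heR : ∀ᶠ g in (F : Filter (G n K)), e g ∈ R := by
    filter_upwards [hFR, hk0.eventually_ne one_ne_zero] with g hg hne
    have hfac := exists_low_mul (n := n) (k g) hne
    set b : G n K := bor (Units.mk0 (k g 0 0) hne) (fun _ => k g 0 1)
    have hbS : b ∈ S := bor_const_mem hw hA _ _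
    have hlow : (fun _ : Fin n => low (ρ g)) = (fun _ => k g) * b⁻¹ := by
      rw [hfac, mul_inv_cancel_right]
    have hkg : (fun _ : Fin n => k g) = w (fun _ => t) * fun _ => g l := rfl
    have hneg : w (fun _ : Fin n => -t) = (w (fun _ => t))⁻¹ := w_neg _
    have hinv : bor (T g)⁻¹ 0 = (bor (T g) (0 : Fin n → K))⁻¹ := by rw [bor_inv, neg_zero]
    have : e g = (bor (T g) 0 * w (fun _ => t)) * g * (b⁻¹ * (bor (T g) 0)⁻¹) := by
      simp only [he, hg']
      rw [hlow, hkg, hneg, hinv]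
      group
    rw [this]
    exact hRS _ (S.mul_mem (hA _) (hw _)) _ (S.mul_mem (S.inv_mem hbS) (S.inv_mem (hA _))) _ hg.1
  refine hR.mem_of_tendsto (f := e) (b := (F : Filter (G n K))) ?_ heR
  have hM00 : ∀ j, Tendsto (fun g => g' g j 0 0 + t * g' g j 1 0) F (𝓝 1) := fun j => by
    simpa using (ha j).add ((hc j).const_mul t)
  have hM11 : ∀ j, Tendsto (fun g => g' g j 1 1 - t * g' g j 1 0) F (𝓝 1) := fun j => by
    simpa using (hd j).sub ((hc j).const_mul t)
  have hVj : ∀ j, Tendsto (fun g => V t g j) F (𝓝 0) := fun j =>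
    ((continuous_apply j).tendsto _).comp (hV t)
  refine tendsto_pi_nhds.2 fun j => tendsto_sl ?_ ?_ ?_ ?_
  · have := (hM00 j).add (hρ.mul (hVj j))
    simp only [zero_mul, add_zero] at this
    simp only [bor_00, Units.val_one]
    refine this.congr fun g => ?_
    have := (T g).ne_zero
    simp [he, sl_mul_apply, w_apply, hV_def]
    field_simp
    ring
  · simp only [bor_01]
    refine (hTv' j).congr fun g => ?_
    simp [he, sl_mul_apply, w_apply, hV_def]
    ring
  · have := (hT.pow 2).mul ((hc j).add (hρ.mul (hM11 j)))
    simp only [zero_mul, add_zero, mul_zero] at this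
    simp only [bor_10]
    refine this.congr fun g => ?_
    simp [he, sl_mul_apply, w_apply]
    ring
  · simp only [bor_11, Units.val_one, inv_one]
    refine (hM11 j).congr fun g => ?_
    have := (T g).ne_zero
    simp [he, sl_mul_apply, w_apply]
    field_simp
    ring

end Torus

/-! ### Minimal sets whose close returns lie in H. -/

section Orbit

variable {n : ℕ} {K : Type*} [NontriviallyNormedField K] {D : Subgroup (G n K)}
  {X : Set (G n K ⧸ D)}

theorem tendsto_low_const {ι : Type*} {F : Filter ι} {f : ι → K} (h : Tendsto f F (𝓝 0)) :
    Tendsto (fun i => (fun _ : Fin n => low (f i))) F (𝓝 (1 : G n K)) := by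
  refine tendsto_pi_nhds.2 fun j => ?_
  refine tendsto_sl ?_ ?_ ?_ ?_
  · exact tendsto_const_nhds
  · exact tendsto_const_nhds
  · exact h
  · exact tendsto_const_nhds

/-- If close returns lie in `H`, a minimal set lies in a single `H`-orbit. -/
theorem IsMinimalSet.exists_const_smul (hX : IsMinimalSet (U n K) X)
    (hnear : ∀ᶠ g in 𝓝 (1 : G n K), g ∈ returns X → g ∈ H n K) {x y : G n K ⧸ D} (hx : x ∈ X)
    (hy : y ∈ X) : ∃ κ, y = (fun _ : Fin n => κ : G n K) • x := by
  have hcl := hX.subset_closure_orbit hx hy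
  have hm := image_mem_map (m := fun g : G n K => g • y) hnear
  rw [map_smul_nhds_one] at hm
  obtain ⟨_, ⟨k, hk, rfl⟩, t, ht⟩ := mem_closure_iff_nhds.1 hcl _ hm
  obtain ⟨κ, rfl⟩ := hk ⟨y, hy, by
    change k • y ∈ X
    have ht' : k • y = _ := ht
    rw [ht']
    exact hX.2.2.1 _ ⟨t, rfl⟩ _ hx⟩
  refine ⟨κ⁻¹ * w₁ t, ?_⟩
  have e : (fun _ : Fin n => κ⁻¹ * w₁ t : G n K) = (fun _ => κ)⁻¹ * w (fun _ => t) := rfl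
  rw [e, mul_smul, ← show _ = w (fun _ => t) • x from ht, inv_smul_smul]

/-- A minimal set stabilized by the torus whose close returns lie in `H` is invariant under the
Weyl element of `H`. -/
theorem IsMinimalSet.weyl_smul_mem [CharZero K] (l : Fin n) [DiscreteTopology D]
    [CompactSpace (G n K ⧸ D)] (hX : IsMinimalSet (U n K) X)
    (hA : ∀ α : Kˣ, bor α 0 ∈ MulAction.stabilizer (G n K) X)
    (hnear : ∀ᶠ g in 𝓝 (1 : G n K), g ∈ returns X → g ∈ H n K) {y : G n K ⧸ D} (hy : y ∈ X) :
    (fun _ => weyl : G n K) • y ∈ X := by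
  obtain ⟨θ, hθ⟩ := exists_unit_two_lt_norm (K := K)
  obtain ⟨c, hc⟩ := exists_frequently_eq_smul fun m : ℕ => bor (θ ^ m) (0 : Fin n → K) • y
  have hB : ∀ (α : Kˣ) (t : K), ∀ x ∈ X, bor α (fun _ => t) • x ∈ X := fun α t x hx =>
    smul_mem_of_mem_stabilizer (bor_const_mem hX.w_mem_stabilizer hA α t) hx
  have hkc : ∀ p : ℕ × G n K, bor (θ ^ p.1) (0 : Fin n → K) • y = p.2 • c → p.2 • c ∈ X :=
    fun p hp => hp ▸ smul_mem_of_mem_stabilizer (hA _) hy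
  have hcX : c ∈ X := by
    refine hX.2.1.mem_of_frequently_of_tendsto (hc.mono hkc) ?_
    have h1 : Tendsto (fun g : G n K => g • c) (𝓝 1) (𝓝 c) := (map_smul_nhds_one c).le
    exact h1.comp tendsto_snd
  -- The question is whether the Weyl translate of the limit point `c` lies in a lower unipotent
  -- translate of X.
  by_cases hcase : ∃ r : K, ∃ x₀ ∈ X,
      (fun _ => weyl : G n K) • c = (fun _ => low r : G n K) • x₀
  · obtain ⟨r, x₀, hx₀, hr⟩ := hcase
    set z := (fun _ => weyl : G n K) • y with hz
    have hE : IsClosed {e : G n K | e⁻¹ • z ∈ X} :=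
      hX.2.1.preimage (continuous_inv.smul continuous_const)
    set N : G n K → Matrix.SpecialLinearGroup (Fin 2) K :=
      fun k => weyl * k l * weyl⁻¹ * low r with hN
    have hNc : Continuous N := by fun_prop
    have hNt : Tendsto (fun p : ℕ × G n K => N p.2) (atTop ×ˢ 𝓝 1) (𝓝 (low r)) := by
      have := (hNc.tendsto 1).comp (tendsto_snd (f := (atTop : Filter ℕ)))
      simpa [hN, Function.comp_def] using this
    have hN0 : Tendsto (fun p : ℕ × G n K => N p.2 0 0) (atTop ×ˢ 𝓝 1) (𝓝 1) :=
      ((continuous_sl_entry 0 0).tendsto (low r)).comp hNt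
    have hN1 : Tendsto (fun p : ℕ × G n K => N p.2 1 0) (atTop ×ˢ 𝓝 1) (𝓝 r) :=
      ((continuous_sl_entry 1 0).tendsto (low r)).comp hNt
    set e : ℕ × G n K → G n K := fun p =>
      fun _ => low ((((θ ^ p.1 : Kˣ) : K))⁻¹ ^ 2 * (N p.2 1 0 / N p.2 0 0)) with he
    have het : Tendsto e (atTop ×ˢ 𝓝 1) (𝓝 1) := by
      refine tendsto_low_const ?_
      have h0 := ((tendsto_inv_pow_zero (θ := (θ : K)) (by linarith)).comp
        (tendsto_fst (f := (atTop : Filter ℕ)) (g := 𝓝 (1 : G n K)))).pow 2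
      have := h0.mul (hN1.div hN0 one_ne_zero)
      simpa [Function.comp_def] using this
    have hfreq : ∃ᶠ p in atTop ×ˢ 𝓝 1, e p ∈ {e : G n K | e⁻¹ • z ∈ X} := by
      refine (hc.and_eventually ((hN0.eventually_ne one_ne_zero).and
        (tendsto_snd.eventually hnear))).mono ?_
      rintro ⟨m, k⟩ ⟨hmk, hne, hk⟩
      obtain ⟨κ, rfl⟩ := hk ⟨c, hcX, hkc _ hmk⟩
      change bor (θ ^ m) (0 : Fin n → K) • y = _ at hmk
      have hfac := exists_low_mul (n := n) _ hne
      -- Write the Weyl element as `a * weyl * a` with `a = bor (θ ^ m) 0`. The right `a` brings `y`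
      -- near `c`, and the left `a` contracts the lower unipotent part, so `z` lies in `e • X` with
      -- `e` tending to 1.
      have hzeq : z = e (m, fun _ => κ) • bor (θ ^ m) (0 : Fin n → K) •
          bor (Units.mk0 _ hne) (fun _ : Fin n => N (fun _ => κ) 0 1) • x₀ := by
        rw [← mul_smul, he, bor_mul_low, mul_smul, ← mul_smul (fun _ => low _ : G n K), ← hfac]
        have e1 : (fun _ : Fin n => N fun _ => κ : G n K) =
            (fun _ => weyl) * (fun _ => κ) * (fun _ => weyl)⁻¹ * (fun _ => low r) := rfl
        rw [e1, mul_smul _ (fun _ => low r : G n K), ← hr, mul_smul, inv_smul_smul, mul_smul,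
          ← hmk, ← mul_smul, ← mul_smul, weyl_conj_bor]
      change (e (m, fun _ => κ))⁻¹ • z ∈ X
      rw [hzeq, inv_smul_smul]
      exact smul_mem_of_mem_stabilizer (hA _) (hB _ _ _ hx₀)
    have := hE.mem_of_frequently_of_tendsto hfreq het
    simpa using this
  · exfalso
    -- If `g 1 0 ≠ 0`, then `weyl * g⁻¹` lies in the open cell, which would put the Weyl translate
    -- of `c` in the excluded position. All close returns are then upper triangular, against
    -- `one_mem_closure_returns_diff`.
    have hup : ∀ g : Matrix.SpecialLinearGroup (Fin 2) K,
        (fun _ => g : G n K) • c ∈ X → g 1 0 = 0 := by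
      intro g hg
      by_contra hg0
      have hne : (weyl * g⁻¹ : Matrix.SpecialLinearGroup (Fin 2) K) 0 0 ≠ 0 := by
        rw [sl_mul_apply, Matrix.SpecialLinearGroup.SL2_inv_expl]
        simpa using hg0
      have hfac := exists_low_mul (n := n) _ hne
      set N : Matrix.SpecialLinearGroup (Fin 2) K := weyl * g⁻¹
      refine hcase ⟨N 1 0 / N 0 0, bor (Units.mk0 (N 0 0) hne) (fun _ => N 0 1) •
        (fun _ => g : G n K) • c, hB _ _ _ hg, ?_⟩
      rw [← mul_smul, ← hfac, ← mul_smul]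
      congr 1
      funext j
      simp
    have hcl := one_mem_closure_returns_diff (show 1 ≤ n from l.pos) hX
    rw [mem_closure_iff_frequently] at hcl
    obtain ⟨g, ⟨⟨x, hx, hgx⟩, hgb⟩, hg⟩ := (hcl.and_eventually hnear).exists
    obtain ⟨h, rfl⟩ := hg ⟨x, hx, hgx⟩
    obtain ⟨b, rfl⟩ := hX.exists_const_smul hnear hcX hx
    have hb := hup b hx
    have hhb := hup (h * b) (by
      rw [← mul_smul] at hgx
      exact hgx)
    have hb0 : b 0 0 ≠ 0 := fun h0 => by
      have := sl_det b
      simp [h0, hb] at this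
    rw [sl_mul_apply, hb, mul_zero, add_zero] at hhb
    obtain ⟨α, hα⟩ := eq_bor_const (n := n) h ((mul_eq_zero.1 hhb).resolve_right hb0)
    exact hgb ⟨α, _, hα⟩

theorem IsMinimalSet.const_smul_mem [CharZero K] (l : Fin n) [DiscreteTopology D]
    [CompactSpace (G n K ⧸ D)] (hX : IsMinimalSet (U n K) X)
    (hA : ∀ α : Kˣ, bor α 0 ∈ MulAction.stabilizer (G n K) X)
    (hnear : ∀ᶠ g in 𝓝 (1 : G n K), g ∈ returns X → g ∈ H n K) {y : G n K ⧸ D} (hy : y ∈ X)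
    (g : Matrix.SpecialLinearGroup (Fin 2) K) : (fun _ => g : G n K) • y ∈ X := by
  have hB : ∀ (α : Kˣ) (t : K), ∀ x ∈ X, bor α (fun _ => t) • x ∈ X := fun α t x hx =>
    smul_mem_of_mem_stabilizer (bor_const_mem hX.w_mem_stabilizer hA α t) hx
  have hW : ∀ x ∈ X, (fun _ => weyl : G n K) • x ∈ X := fun x hx =>
    hX.weyl_smul_mem l hA hnear hx
  by_cases h0 : g 1 0 = 0
  · obtain ⟨α, hα⟩ := eq_bor_const (n := n) g h0
    rw [hα]
    exact hB _ _ _ hy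
  · obtain ⟨α, hα⟩ : ∃ α : Kˣ, (α : K) = g 1 0 := ⟨Units.mk0 _ h0, rfl⟩
    have hdet := sl_det g
    -- Bruhat decomposition
    have e : (fun _ => g : G n K) = bor 1 (fun _ => g 0 0 / g 1 0) *
        ((fun _ => weyl) * bor (-α) (fun _ => - g 1 1)) := by
      funext j
      apply sl_ext
      · simp [sl_mul_apply, hα, h0]
      · simp [sl_mul_apply, hα]
        field_simp
        linear_combination -hdet
      · simp [sl_mul_apply, hα]
      · simp [sl_mul_apply]
    rw [e, mul_smul, mul_smul]
    exact hB _ _ _ (hW _ (hB _ _ _ hy))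

/-- A minimal set stabilized by the torus whose close returns lie in `H` is an `H`-orbit. -/
theorem IsMinimalSet.isClosedOrbit_H [CharZero K] (l : Fin n) [DiscreteTopology D]
    [CompactSpace (G n K ⧸ D)] (hX : IsMinimalSet (U n K) X)
    (hA : ∀ α : Kˣ, bor α 0 ∈ MulAction.stabilizer (G n K) X)
    (hnear : ∀ᶠ g in 𝓝 (1 : G n K), g ∈ returns X → g ∈ H n K) :
    IsClosedOrbit (H n K) X := by
  obtain ⟨x, hx⟩ := hX.1
  refine ⟨hX.2.1, x, Set.Subset.antisymm (fun y hy => ?_) ?_⟩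
  · obtain ⟨κ, rfl⟩ := hX.exists_const_smul hnear hx hy
    exact ⟨_, ⟨κ, rfl⟩, rfl⟩
  · rintro _ ⟨_, ⟨κ, rfl⟩, rfl⟩
    exact hX.const_smul_mem l hA hnear hx κ

end Orbit

/-! ### Reduction of a conjugate torus to the diagonal one, and the dichotomy. -/

section Translate

variable {n : ℕ} {K : Type*} [NontriviallyNormedField K] {D : Subgroup (G n K)}
  {X : Set (G n K ⧸ D)}

theorem w_commute (s t : Fin n → K) : w s * w t = w t * w s := by
  rw [← w_add, add_comm, w_add]

theorem IsInvariant.w_smul {Y : Set (G n K ⧸ D)} (hY : IsInvariant (U n K) Y) (z : Fin n → K) :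
    IsInvariant (U n K) (w z • Y) := by
  rintro _ ⟨t, rfl⟩ _ ⟨y, hy, rfl⟩
  change w _ • w z • y ∈ _
  rw [← mul_smul, w_commute, mul_smul]
  exact Set.smul_mem_smul_set (hY _ ⟨t, rfl⟩ _ hy)

theorem IsMinimalSet.w_smul (hX : IsMinimalSet (U n K) X) (z : Fin n → K) :
    IsMinimalSet (U n K) (w z • X) := by
  refine ⟨hX.1.smul_set, hX.2.1.smul _, hX.2.2.1.w_smul z, fun Y hYX hY hYc hYi => ?_⟩
  have h := hX.2.2.2 (w (-z) • Y) ?_ hY.smul_set (hYc.smul _) (hYi.w_smul _)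
  · rw [← h, w_neg, smul_inv_smul]
  · rw [w_neg]
    exact Set.subset_smul_set_iff.1 hYX

/-- The dichotomy for minimal sets in the quotient by a discrete cocompact subgroup. -/
theorem IsMinimalSet.dichotomy [LocallyCompactSpace K] [CharZero K] (l : Fin n)
    [DiscreteTopology D] [CompactSpace (G n K ⧸ D)] (hX : IsMinimalSet (U n K) X) :
    (∃ z : Fin n → K, z l = 0 ∧ IsClosedOrbit (conj (w z) (H n K)) X) ∨
      ∃ v : Fin n → K, v ≠ 0 ∧ v l = 0 ∧
        ∀ s : K, w (s • v) ∈ MulAction.stabilizer (G n K) X := by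
  obtain ⟨γ, p, q, hp, hq, h0, hcurve⟩ := exists_limit_curve l (isClosed_returns hX.2.1)
    (fun g hg s t => mul_mem_returns (hX.w_mem_stabilizer s) (hX.w_mem_stabilizer t) hg)
    (one_mem_closure_returns_diff l.pos hX)
  rcases line_or_torus_of_curve l hp hq h0
    (fun τ α hα => hX.bor_mem_stabilizer (hcurve τ α hα)) with h | ⟨z, hz, hzA⟩
  · exact Or.inr h
  have hX' : IsMinimalSet (U n K) ((w z)⁻¹ • X) := by
    rw [← w_neg]
    exact hX.w_smul _
  have hA : ∀ α : Kˣ, bor α 0 ∈ MulAction.stabilizer (G n K) ((w z)⁻¹ • X) := fun α => by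
    rw [MulAction.mem_stabilizer_iff]
    conv_rhs => rw [← MulAction.mem_stabilizer_iff.1 (hzA α)]
    simp only [← mul_smul]
    congr 1
    group
  by_cases h1 : (1 : G n K) ∈ closure (returns ((w z)⁻¹ • X) \ H n K)
  · right
    obtain ⟨v, hv, hvl, hvS⟩ := line_of_one_mem_closure_diff l (isClosed_returns hX'.2.1)
      (fun a ha b hb g hg => mul_mem_returns ha hb hg) hX'.w_mem_stabilizer hA
      (fun α v h => hX'.bor_mem_stabilizer h) h1
    refine ⟨v, hv, hvl, fun s => ?_⟩
    have h2 := MulAction.mem_stabilizer_iff.1 (hvS s)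
    rw [← w_neg, ← mul_smul, w_commute, mul_smul, w_neg, smul_left_cancel_iff] at h2
    exact MulAction.mem_stabilizer_iff.2 h2
  · left
    rw [mem_closure_iff_frequently, not_frequently] at h1
    obtain ⟨-, x, hx⟩ := hX'.isClosedOrbit_H l hA (h1.mono fun g hg hgr => by
      by_contra hgH
      exact hg ⟨hgr, hgH⟩)
    refine ⟨z, hz, hX.2.1, w z • x, ?_⟩
    rw [inv_smul_eq_iff] at hx
    rw [hx]
    ext y
    constructor
    · rintro ⟨_, ⟨g, hg, rfl⟩, rfl⟩
      refine ⟨w z * g * (w z)⁻¹, ⟨g, hg, rfl⟩, ?_⟩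
      change w z • g • x = _
      rw [mul_smul, inv_smul_smul, mul_smul]
    · rintro ⟨_, ⟨g, hg, rfl⟩, rfl⟩
      refine ⟨g • x, ⟨g, hg, rfl⟩, ?_⟩
      change w z • g • x = (w z * g * (w z)⁻¹) • w z • x
      rw [mul_smul, inv_smul_smul, mul_smul]

end Translate

/-! ### Discreteness and cocompactness of a product of subgroups. -/

section Product

variable {ι : Type*} {A : ι → Type*} [∀ i, Group (A i)] [∀ i, TopologicalSpace (A i)]
  (Γ : ∀ i, Subgroup (A i))

theorem discreteTopology_pi [Finite ι] [∀ i, DiscreteTopology (Γ i)] :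
    DiscreteTopology (Subgroup.pi Set.univ Γ) := by
  let f : Subgroup.pi Set.univ Γ → ∀ i, Γ i := fun g i => ⟨g.1 i, g.2 i trivial⟩
  have hf : Continuous f := continuous_pi fun i =>
    ((continuous_apply i).comp continuous_subtype_val).subtype_mk _
  exact DiscreteTopology.of_continuous_injective hf fun a b h =>
    Subtype.ext (funext fun i => congrArg Subtype.val (congrFun h i))

/-- The quotient is a continuous image of the product of the compact quotients: a product of open
quotient maps is a quotient map, so continuity can be tested on the groups, where the choice of
representatives disappears. -/
theorem compactSpace_quotient_pi [∀ i, IsTopologicalGroup (A i)] [∀ i, CompactSpace (A i ⧸ Γ i)] :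
    CompactSpace ((∀ i, A i) ⧸ Subgroup.pi Set.univ Γ) := by
  let f : (∀ i, A i ⧸ Γ i) → (∀ i, A i) ⧸ Subgroup.pi Set.univ Γ :=
    fun y => QuotientGroup.mk fun i => (y i).out
  have hcomp : f ∘ Pi.map (fun i (a : A i) => (a : A i ⧸ Γ i)) = QuotientGroup.mk := by
    funext a
    refine QuotientGroup.eq.2 fun i _ => ?_
    exact QuotientGroup.eq.1 (QuotientGroup.out_eq' (a i : A i ⧸ Γ i))
  have hf : Continuous f := by
    rw [(IsOpenQuotientMap.piMap fun i => QuotientGroup.isOpenQuotientMap_mk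
      (N := Γ i)).isQuotientMap.continuous_iff, hcomp]
    exact QuotientGroup.continuous_mk
  have hs : Function.Surjective f := Function.Surjective.of_comp (g := Pi.map _) (by
    rw [hcomp]
    exact QuotientGroup.mk_surjective)
  exact hs.compactSpace hf

end Product

end UnipotentFlow

theorem theorem3p3 (K : Type*) [NontriviallyNormedField K] [LocallyCompactSpace K] [CharZero K]
    (n : ℕ) (hn : 1 ≤ n)
    (Γ : Fin n → Subgroup (Matrix.SpecialLinearGroup (Fin 2) K))
    (hdiscrete : ∀ j, DiscreteTopology (Γ j))
    (hcocompact : ∀ j, CompactSpace (Matrix.SpecialLinearGroup (Fin 2) K ⧸ Γ j))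
    (X : Set (UnipotentFlow.G n K ⧸ Subgroup.pi Set.univ Γ))
    (hX : UnipotentFlow.IsMinimalSet (UnipotentFlow.U n K) X) :
    (∃ w ∈ UnipotentFlow.Uperp n K,
      UnipotentFlow.IsClosedOrbit (UnipotentFlow.conj w (UnipotentFlow.H n K)) X) ∨
    (∃ V : Subgroup (UnipotentFlow.G n K), UnipotentFlow.IsNontrivialOneParameter V ∧
      V ≤ UnipotentFlow.Uperp n K ∧ UnipotentFlow.IsInvariant V X) := by
  have := UnipotentFlow.discreteTopology_pi Γ
  have : CompactSpace (UnipotentFlow.G n K ⧸ Subgroup.pi Set.univ Γ) :=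
    UnipotentFlow.compactSpace_quotient_pi Γ
  have hlast : ∀ {t : Fin n → K}, t ⟨n - 1, by omega⟩ = 0 →
      ∀ i : Fin n, (i : ℕ) + 1 = n → t i = 0 := by
    intro t ht i hi
    rw [← ht]
    congr 1
    exact Fin.ext (by change (i : ℕ) = n - 1; omega)
  rcases hX.dichotomy (⟨n - 1, by omega⟩ : Fin n) with ⟨z, hz, h⟩ | ⟨v, hv, hvl, h⟩
  · exact Or.inl ⟨UnipotentFlow.w z, ⟨z, hlast hz, rfl⟩, h⟩
  · refine Or.inr ⟨_, ⟨v, hv, rfl⟩, ?_, ?_⟩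
    · rintro _ ⟨t, ht, rfl⟩
      obtain ⟨s, rfl⟩ := Submodule.mem_span_singleton.1 ht
      exact ⟨_, hlast (by simp [hvl]), rfl⟩
    · rintro _ ⟨t, ht, rfl⟩ x hx
      obtain ⟨s, rfl⟩ := Submodule.mem_span_singleton.1 ht
      exact UnipotentFlow.smul_mem_of_mem_stabilizer (h s) hx
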